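/- **Theorem 1.2.** All groups are finite. Let $\sigma=\{\sigma_i\mid i\in I\}$ be a partition of the set of all primes. For a positive integer $n$ let $\sigma(n)$ be the set of those $\sigma_i$ that contain a prime divisor of $n$, and put $\sigma(G)=\sigma(|G|)$; $\pi(G)$ is the set of prime divisors of $|G|$. A group is *$\sigma$-primary* if it is a $\sigma_i$-group for some $i$; *$\sigma$-nilpotent* if it is a direct product of finitely many $\sigma$-primary groups; *$\sigma$-soluble* if each of its chief factors is $\sigma$-primary. For a $\sigma$-soluble group $G$, $l_\sigma(G)$ is the length $t$ of the shortest chain $1=G_0\le G_1\le\dots\le G_t=G$ of normal subgroups of $G$ with all factors $G_i/G_{i-1}$ $\sigma$-nilpotent. The rank $r(G)$ of a soluble group $G$ is the largest $k$ such that $G$ has a chief factor of order $p^k$ for some prime $p$ (and $r(1)=0$). A *Hall $\sigma_i$-subgroup* of $G$ is a subgroup $H$ such that all prime divisors of $|H|$ are in $\sigma_i$ and no prime divisor of $|G:H|$ is in $\sigma_i$. A set $\mathcal H$ of subgroups of $G$ is a *complete Hall $\sigma$-set* of $G$ if every member $\neq 1$ of $\mathcal H$ is a Hall $\sigma_i$-subgroup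 of $G$ for some $i$, and $\mathcal H$ contains exactly one Hall $\sigma_i$-subgroup of $G$ for every $\sigma_i\in\sigma(G)$. A subgroup $A$ of $G$ is *$\sigma$-subnormal* in $G$ if there is a chain $A=A_0\le A_1\le\dots\le A_t=G$ such that, for each $i=1,\dots,t$, either $A_{i-1}\trianglelefteq A_i$ or $A_i/(A_{i-1})_{A_i}$ is $\sigma$-primary, where $(A_{i-1})_{A_i}$ is the largest normal subgroup of $A_i$ contained in $A_{i-1}$. A subgroup $A$ is *$\sigma$-quasinormal* in $G$ if $G$ has a complete Hall $\sigma$-set $\mathcal K$ such that $AH^x=H^xA$ for all $H\in\mathcal K$ and $x\in G$. For $n\ge 1$, an *$n$-maximal* subgroup of $G$ is the last entry $M_n$ of a chain $M_n<M_{n-1}<\dots<M_0=G$ in which each $M_i$ is a maximal subgroup of $M_{i-1}$. Write $m_\sigma(G)$ (respectively $m_{\sigma q}(G)$) for the least $n\ge 1$ such that each $n$-maximal subgroup of $G$ is $\sigma$-subnormal (respectively $\sigma$-quasinormal) in $G$ but, if $n>1$, some $(n-1)$-maximal subgroup of $G$ is not. Let $G$ be $\sigma$-soluble and let $\mathcal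 H$ be a complete Hall $\sigma$-set of $G$. Then: (i) If $G$ is soluble but not $\sigma$-nilpotent, and $r\in\mathbb N$ is such that $r(H)\le r$ for all $H\in\mathcal H$, then $r(G)\le m_{\sigma q}(G)+r-2$. (ii) $l_\sigma(G)\le m_\sigma(G)$. (iii) If $G$ is soluble but not $\sigma$-nilpotent, then $|\pi(G)|\le m_\sigma(G)$. -/

import Mathlib

open scoped Pointwise

namespace SigmaGroup

universe u

/-- `n` is an `s`-number: all prime divisors of `n` lie in the set of primes `s`. -/
def IsPiNumber (s : Set Nat.Primes) (n : ℕ) : Prop :=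
  ∀ p : Nat.Primes, (p : ℕ) ∣ n → p ∈ s

/-- `σ(n)`: the members of `σ` that contain a prime divisor of `n`. -/
def sigmaOf (σ : Set (Set Nat.Primes)) (n : ℕ) : Set (Set Nat.Primes) :=
  {s | s ∈ σ ∧ ∃ p ∈ s, (p : ℕ) ∣ n}

/-- `n` is a `σᵢ`-number for some member `σᵢ` of `σ`. A finite group is `σ`-primary if and only if
its order has this property. -/
def IsPrimaryNumber (σ : Set (Set Nat.Primes)) (n : ℕ) : Prop :=
  ∃ s ∈ σ, IsPiNumber s n

/-- `G` is `σ`-primary: it is a `σᵢ`-group for some member `σᵢ` of `σ`. -/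
def IsSigmaPrimary (σ : Set (Set Nat.Primes)) (G : Type u) [Group G] : Prop :=
  IsPrimaryNumber σ (Nat.card G)

/-- `G` is `σ`-nilpotent: it is the (internal) direct product of finitely many `σ`-primary
groups. -/
def IsSigmaNilpotent (σ : Set (Set Nat.Primes)) (G : Type u) [Group G] : Prop :=
  ∃ (r : ℕ) (A : Fin r → Subgroup G),
    (∀ i, (A i).Normal) ∧ iSupIndep A ∧ (⨆ i, A i) = ⊤ ∧ ∀ i, IsSigmaPrimary σ (A i)

variable {G : Type u} [Group G]

/-- `H / K` is a chief factor of `G`. Its order is `K.relIndex H`. -/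
def IsChiefFactor (K H : Subgroup G) : Prop :=
  K.Normal ∧ H.Normal ∧ K < H ∧
    ∀ N : Subgroup G, N.Normal → K ≤ N → N ≤ H → N = K ∨ N = H

/-- `G` is `σ`-soluble: every chief factor of `G` is `σ`-primary. -/
def IsSigmaSoluble (σ : Set (Set Nat.Primes)) (G : Type u) [Group G] : Prop :=
  ∀ K H : Subgroup G, IsChiefFactor K H → IsPrimaryNumber σ (K.relIndex H)

/-- `G` has a chain `1 = c 0 ≤ c 1 ≤ ⋯ ≤ c t = G` of normal subgroups of `G` all of whose factors
`c (i + 1) / c i` are `σ`-nilpotent. -/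
def HasSigmaNilpotentChain (σ : Set (Set Nat.Primes)) (G : Type u) [Group G] (t : ℕ) : Prop :=
  ∃ (c : Fin (t + 1) → Subgroup G) (_ : ∀ i, (c i).Normal),
    c 0 = ⊥ ∧ c (Fin.last t) = ⊤ ∧
      ∀ i : Fin t, c i.castSucc ≤ c i.succ ∧
        IsSigmaNilpotent σ (c i.succ ⧸ (c i.castSucc).subgroupOf (c i.succ))

/-- The `σ`-nilpotent length `l_σ(G)`: the length of the shortest normal chain of `G` with
`σ`-nilpotent factors (and `⊤` if there is no such chain). -/
noncomputable def sigmaNilpotentLength (σ : Set (Set Nat.Primes)) (G : Type u) [Group G] : ℕ∞ :=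
  ⨅ (t : ℕ) (_ : HasSigmaNilpotentChain σ G t), (t : ℕ∞)

/-- The rank `r(G)` of a finite soluble group: the largest `k` such that `G` has a chief factor of
order `p ^ k` for some prime `p` (and `0` if `G` is trivial). -/
noncomputable def chiefRank (G : Type u) [Group G] : ℕ :=
  sSup {k | ∃ p : ℕ, p.Prime ∧ ∃ K H : Subgroup G, IsChiefFactor K H ∧ K.relIndex H = p ^ k}

/-- `H` is a Hall `s`-subgroup of `G`. -/
def IsHall (s : Set Nat.Primes) (H : Subgroup G) : Prop :=
  IsPiNumber s (Nat.card H) ∧ IsPiNumber sᶜ H.index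

/-- `𝓗` is a complete Hall `σ`-set of `G`. -/
def IsCompleteHallSet (σ : Set (Set Nat.Primes)) (𝓗 : Set (Subgroup G)) : Prop :=
  (∀ H ∈ 𝓗, H ≠ ⊥ → ∃ s ∈ σ, IsHall s H) ∧
    ∀ s ∈ sigmaOf σ (Nat.card G), ∃! H : Subgroup G, H ∈ 𝓗 ∧ IsHall s H

/-- `H` is `σ`-quasinormal (`σ`-permutable) in `G`: for some complete Hall `σ`-set `𝓗` of `G`, `H`
permutes with all conjugates of all members of `𝓗`. -/
def IsSigmaQuasinormal (σ : Set (Set Nat.Primes)) (H : Subgroup G) : Prop :=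
  ∃ 𝓗 : Set (Subgroup G), IsCompleteHallSet σ 𝓗 ∧ ∀ A ∈ 𝓗, ∀ x : G,
    (H : Set G) * ((MulAut.conj x • A : Subgroup G) : Set G) =
      ((MulAut.conj x • A : Subgroup G) : Set G) * (H : Set G)

/-- One step `A ≤ B` of a `σ`-subnormal chain: `A` is normal in `B`, or `B / A_B` is `σ`-primary,
where `A_B` is the largest normal subgroup of `B` contained in `A`. -/
def SigmaSubnormalStep (σ : Set (Set Nat.Primes)) (A B : Subgroup G) : Prop :=
  A ≤ B ∧ ((A.subgroupOf B).Normal ∨ IsSigmaPrimary σ (B ⧸ (A.subgroupOf B).normalCore))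

/-- `A` is `σ`-subnormal in `G`: there is a chain `A = A₀ ≤ A₁ ≤ ⋯ ≤ Aₜ = G` in which every
`Aᵢ ≤ Aᵢ₊₁` is a step as above. -/
def IsSigmaSubnormal (σ : Set (Set Nat.Primes)) (A : Subgroup G) : Prop :=
  Relation.ReflTransGen (SigmaSubnormalStep σ) A ⊤

/-- `H` is the last entry of a maximal chain `H = Mₙ < ⋯ < M₁ < M₀ = G`, where each `Mᵢ₊₁` is a
maximal subgroup of `Mᵢ`. For `n > 0` this says that `H` is an `n`-maximal subgroup of `G`. -/
def IsNMaximal : ℕ → Subgroup G → Prop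
  | 0, H => H = ⊤
  | n + 1, H => ∃ M : Subgroup G, IsNMaximal n M ∧ H ⋖ M

/-- `n ≥ 1`, each `n`-maximal subgroup of `G` has the property `P`, and if `n > 1`, then some
`(n - 1)`-maximal subgroup of `G` does not have the property `P`. -/
def IsMaximalityIndex (P : Subgroup G → Prop) (n : ℕ) : Prop :=
  0 < n ∧ (∀ H : Subgroup G, IsNMaximal n H → P H) ∧
    (1 < n → ∃ H : Subgroup G, IsNMaximal (n - 1) H ∧ ¬ P H)

/-- The (least) `n` with `IsMaximalityIndex P n`; it exists whenever `G` is finite, see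
`maximalityIndex_spec`. -/
noncomputable def maximalityIndex (P : Subgroup G → Prop) : ℕ :=
  sInf {n | IsMaximalityIndex P n}

/-- `m_σ(G)`. -/
noncomputable def mSigma (σ : Set (Set Nat.Primes)) (G : Type u) [Group G] : ℕ :=
  maximalityIndex (fun H : Subgroup G => IsSigmaSubnormal σ H)

/-- `m_{σq}(G)`. -/
noncomputable def mSigmaQ (σ : Set (Set Nat.Primes)) (G : Type u) [Group G] : ℕ :=
  maximalityIndex (fun H : Subgroup G => IsSigmaQuasinormal σ H)

theorem IsNMaximal.card_add_le [Finite G] {n : ℕ} {H : Subgroup G} (h : IsNMaximal n H) :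
    Nat.card H + n ≤ Nat.card G := by
  induction n generalizing H with
  | zero => simpa using Subgroup.card_le_card_group H
  | succ n ih =>
    obtain ⟨M, hM, hHM⟩ := h
    have h1 := ih hM
    have h2 : Nat.card H < Nat.card M :=
      Set.Finite.card_lt_card (Set.toFinite (M : Set G)) (SetLike.coe_ssubset_coe.2 hHM.lt)
    omega

/-- In a finite group the defining set of `maximalityIndex` is nonempty. -/
theorem maximalityIndex_spec [Finite G] (P : Subgroup G → Prop) :
    IsMaximalityIndex P (maximalityIndex P) := by
  classical
  have hex : ∃ n, 0 < n ∧ ∀ H : Subgroup G, IsNMaximal n H → P H := by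
    refine ⟨Nat.card G, Nat.card_pos, fun H hH => ?_⟩
    have h1 := hH.card_add_le
    have h2 : 0 < Nat.card H := Nat.card_pos
    omega
  refine Nat.sInf_mem (s := {n | IsMaximalityIndex P n}) ⟨Nat.find hex, ?_⟩
  refine ⟨(Nat.find_spec hex).1, (Nat.find_spec hex).2, fun h => ?_⟩
  have h3 := Nat.find_min hex (m := Nat.find hex - 1) (by omega)
  by_contra hcon
  refine h3 ⟨by omega, fun H hH => ?_⟩
  by_contra hP
  exact hcon ⟨H, hH, hP⟩

/-- In a finite group the supremum that defines `chiefRank` is over a bounded set. -/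
theorem chiefRank_bddAbove [Finite G] :
    BddAbove {k | ∃ p : ℕ, p.Prime ∧ ∃ K H : Subgroup G,
      IsChiefFactor K H ∧ K.relIndex H = p ^ k} := by
  refine ⟨Nat.card G, ?_⟩
  rintro k ⟨p, hp, K, H, -, hk⟩
  have h1 : k < p ^ k := Nat.lt_pow_self hp.one_lt
  have h2 : K.relIndex H ≤ Nat.card H := Nat.le_of_dvd Nat.card_pos (Subgroup.relIndex_dvd_card K H)
  have h3 : Nat.card H ≤ Nat.card G := Subgroup.card_le_card_group H
  omega

end SigmaGroup

/-!
The proof uses neither the theorem of Feit and Thompson nor the theory of formations. A finite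
`σ`-soluble group has a normal series with `σ`-primary factors (`HasPrimarySeries`), which is
inherited by subgroups and quotients, and most arguments are inductions along a minimal normal
subgroup `R`, which is an `s`-group for some `s ∈ σ`. A `q`-element is an element of `q`-power
order.

*The `σ`-nilpotent length* (`nilpotentChain_of_isSigmaSubnormal`). If all `n`-maximal subgroups
are `σ`-subnormal, then `G` has a normal chain of length `n` with `σ`-nilpotent factors. This holds
for `G ⧸ R` by induction. If `R` lies in the Frattini subgroup, then `R` is abelian, and the chain
lifts by Gaschütz's argument: a Hall subgroup that is normal modulo `R` is normal, by the Frattini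
argument for the complements of the Schur-Zassenhaus theorem. Otherwise `G = M R` with `M` maximal;
by induction `M`, hence `G ⧸ R`, has a chain of length `n - 1`, unless `n = 1`, where `G ⧸ Core M`
is `σ`-primary. The case `n = 1` says that `G` is `σ`-nilpotent if its maximal subgroups are
`σ`-subnormal.

*The number of primes* (`card_primeFactors_le_of_isSigmaSubnormal`). Let `H` be an `(m - 1)`-maximal
subgroup that is not `σ`-subnormal. Its maximal subgroups are `σ`-subnormal. Joins of `σ`-subnormal
subgroups are `σ`-subnormal (`IsSigmaSubnormal.sup`), so `H` has only one maximal subgroup and is a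
`p`-group. The index of `H` is a product of `m - 1` prime powers, as `G` is soluble.

*The rank* (`chiefRank_le_add_sub_two`). Let `H / K` be a chief factor of order `p ^ k`, `p ∈ s ∈ σ`. If
all subgroups of `H / K` are normalized by the `q`-elements of `G / K`, `q ∉ s`, then a Hall
`s`-subgroup acts irreducibly on `H / K`, which is therefore one of its chief factors
(`IsChiefFactor.subgroupOf_isHall`). Otherwise `k < m` (`lt_or_conj_mem_zpowers`): a `q`-element `x`
that acts nontrivially on `R = H / K` yields `m`-maximal subgroups that meet `R` in an arbitrary
subgroup of a certain order. The facts used about a `σ`-quasinormal subgroup `V` are that `V` is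
`σ`-subnormal and that `V ⊓ R` is normalized by the `q`-elements.
-/

namespace SigmaGroup

universe u

variable {σ : Set (Set Nat.Primes)} {G : Type u} [Group G] {G' : Type u} [Group G']

/-! ### Prime sets and indices -/

theorem IsPiNumber.of_dvd {s : Set Nat.Primes} {m n : ℕ} (h : IsPiNumber s n) (hmn : m ∣ n) :
    IsPiNumber s m :=
  fun p hp => h p (hp.trans hmn)

theorem IsPiNumber.mul {s : Set Nat.Primes} {m n : ℕ} (hm : IsPiNumber s m)
    (hn : IsPiNumber s n) : IsPiNumber s (m * n) :=
  fun p hp => (p.2.dvd_mul.1 hp).elim (hm p) (hn p)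

theorem isPiNumber_one (s : Set Nat.Primes) : IsPiNumber s 1 :=
  fun p hp => absurd (Nat.dvd_one.1 hp) p.2.one_lt.ne'

theorem IsPiNumber.coprime {s : Set Nat.Primes} {m n : ℕ} (hm : IsPiNumber s m)
    (hn : IsPiNumber sᶜ n) : m.Coprime n :=
  Nat.Coprime.symm (Nat.coprime_of_dvd fun p hp h1 h2 => hn ⟨p, hp⟩ h1 (hm ⟨p, hp⟩ h2))

theorem IsPiNumber.pow {s : Set Nat.Primes} {p : Nat.Primes} (hp : p ∈ s) (k : ℕ) :
    IsPiNumber s ((p : ℕ) ^ k) := fun q hq => by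
  have : q = p := Subtype.ext ((Nat.prime_dvd_prime_iff_eq q.2 p.2).1 (q.2.dvd_of_dvd_pow hq))
  exact this ▸ hp

theorem eq_of_mem_of_mem (hσ : Setoid.IsPartition σ) {s t : Set Nat.Primes} (hs : s ∈ σ)
    (ht : t ∈ σ) {p : Nat.Primes} (hps : p ∈ s) (hpt : p ∈ t) : s = t :=
  (hσ.2 p).unique ⟨hs, hps⟩ ⟨ht, hpt⟩

theorem IsPiNumber.compl_of_ne (hσ : Setoid.IsPartition σ) {s t : Set Nat.Primes} (hs : s ∈ σ)
    (ht : t ∈ σ) (hst : s ≠ t) {n : ℕ} (h : IsPiNumber t n) : IsPiNumber sᶜ n :=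
  fun p hp hps => hst (eq_of_mem_of_mem hσ hs ht hps (h p hp))

theorem relIndex_map_dvd (f : G →* G') (A B : Subgroup G) :
    (A.map f).relIndex (B.map f) ∣ A.relIndex B := by
  rw [← Subgroup.relIndex_comap]
  exact Subgroup.relIndex_dvd_of_le_left B (Subgroup.le_comap_map f A)

theorem relIndex_dvd_of_le_normalizer {A B C : Subgroup G} (hCB : C ≤ B)
    (hB : B ≤ Subgroup.normalizer (A : Set G)) : A.relIndex C ∣ A.relIndex B := by
  have : (A.subgroupOf B).Normal := Subgroup.normal_subgroupOf_of_le_normalizer hB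
  rw [← Subgroup.relIndex_subgroupOf hCB]
  exact Subgroup.relIndex_dvd_index_of_normal _ _

theorem relIndex_comap_dvd (f : G →* G') {A B : Subgroup G'}
    (hB : B ≤ Subgroup.normalizer (A : Set G')) :
    (A.comap f).relIndex (B.comap f) ∣ A.relIndex B := by
  rw [Subgroup.relIndex_comap]
  exact relIndex_dvd_of_le_normalizer (Subgroup.map_comap_le f B) hB

/-! ### `σ`-subnormal subgroups -/

/-- The steps of a `σ`-subnormal chain, without quotient groups: a primary step from `A` to `B`
is witnessed by some `N ≤ A` that is normal in `B` and whose index in `B` is a `σ`-primary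
number. -/
theorem sigmaSubnormalStep_iff {A B : Subgroup G} [Finite G] :
    SigmaSubnormalStep σ A B ↔ A ≤ B ∧ (B ≤ Subgroup.normalizer (A : Set G) ∨
      ∃ s ∈ σ, ∃ N ≤ A, B ≤ Subgroup.normalizer (N : Set G) ∧ IsPiNumber s (N.relIndex B)) := by
  refine and_congr_right fun hAB => or_congr
    (Subgroup.normal_subgroupOf_iff_le_normalizer hAB) ⟨?_, ?_⟩
  · rintro ⟨s, hs, h⟩
    set c := (A.subgroupOf B).normalCore with hc
    have hNB : c.map B.subtype ≤ B := Subgroup.map_subtype_le c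
    have hcN : (c.map B.subtype).subgroupOf B = c :=
      Subgroup.comap_map_eq_self_of_injective B.subtype_injective c
    refine ⟨s, hs, c.map B.subtype, ?_, ?_, ?_⟩
    · exact Subgroup.map_le_iff_le_comap.2 (Subgroup.normalCore_le _)
    · rw [← Subgroup.normal_subgroupOf_iff_le_normalizer hNB, hcN]
      infer_instance
    · rwa [Subgroup.relIndex, hcN, Subgroup.index_eq_card]
  · rintro ⟨s, hs, N, hNA, hBN, h⟩
    have : (N.subgroupOf B).Normal := Subgroup.normal_subgroupOf_of_le_normalizer hBN
    refine ⟨s, hs, ?_⟩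
    rw [← Subgroup.index_eq_card]
    exact h.of_dvd (Subgroup.index_dvd_of_le
      (Subgroup.normal_le_normalCore.2 (Subgroup.comap_mono hNA)))

/-- `A` is `σ`-subnormal in the subgroup `B`: the relative form of `IsSigmaSubnormal`. -/
def SigmaSubnormalIn (σ : Set (Set Nat.Primes)) (A B : Subgroup G) : Prop :=
  Relation.ReflTransGen (SigmaSubnormalStep σ) A B

theorem SigmaSubnormalIn.le {A B : Subgroup G} (h : SigmaSubnormalIn σ A B) : A ≤ B := by
  induction h with
  | refl => exact le_rfl
  | tail _ h ih => exact ih.trans h.1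

theorem SigmaSubnormalIn.comap [Finite G] [Finite G'] (f : G →* G') {A B : Subgroup G'}
    (h : SigmaSubnormalIn σ A B) : SigmaSubnormalIn σ (A.comap f) (B.comap f) := by
  refine Relation.ReflTransGen.lift (Subgroup.comap f) (fun A B h => ?_) _ _ h
  rw [sigmaSubnormalStep_iff] at h
  rw [Function.onFun, sigmaSubnormalStep_iff]
  refine ⟨Subgroup.comap_mono h.1, h.2.imp
    (fun hN => (Subgroup.comap_mono hN).trans (Subgroup.le_normalizer_comap f)) ?_⟩
  rintro ⟨s, hs, N, hNA, hBN, hN⟩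
  exact ⟨s, hs, N.comap f, Subgroup.comap_mono hNA,
    (Subgroup.comap_mono hBN).trans (Subgroup.le_normalizer_comap f),
    hN.of_dvd (relIndex_comap_dvd f hBN)⟩

theorem SigmaSubnormalIn.map [Finite G] [Finite G'] (f : G →* G') {A B : Subgroup G}
    (h : SigmaSubnormalIn σ A B) : SigmaSubnormalIn σ (A.map f) (B.map f) := by
  refine Relation.ReflTransGen.lift (Subgroup.map f) (fun A B h => ?_) _ _ h
  rw [sigmaSubnormalStep_iff] at h
  rw [Function.onFun, sigmaSubnormalStep_iff]
  refine ⟨Subgroup.map_mono h.1, h.2.imp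
    (fun hN => (Subgroup.map_mono hN).trans (Subgroup.le_normalizer_map f)) ?_⟩
  rintro ⟨s, hs, N, hNA, hBN, hN⟩
  exact ⟨s, hs, N.map f, Subgroup.map_mono hNA,
    (Subgroup.map_mono hBN).trans (Subgroup.le_normalizer_map f),
    hN.of_dvd (relIndex_map_dvd f N B)⟩

theorem isSigmaSubnormal_subgroupOf [Finite G] {A : Subgroup G} (h : IsSigmaSubnormal σ A)
    (B : Subgroup G) : IsSigmaSubnormal σ (A.subgroupOf B) := by
  have := SigmaSubnormalIn.comap B.subtype (B := ⊤) h
  rwa [Subgroup.comap_top] at this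

theorem IsSigmaSubnormal.comap [Finite G] [Finite G'] (f : G →* G') {A : Subgroup G'}
    (h : IsSigmaSubnormal σ A) : IsSigmaSubnormal σ (A.comap f) := by
  have := SigmaSubnormalIn.comap f (B := ⊤) h
  rwa [Subgroup.comap_top] at this

theorem IsSigmaSubnormal.map [Finite G] [Finite G'] {f : G →* G'} (hf : Function.Surjective f)
    {A : Subgroup G} (h : IsSigmaSubnormal σ A) : IsSigmaSubnormal σ (A.map f) := by
  have := SigmaSubnormalIn.map f (B := ⊤) h
  rwa [Subgroup.map_top_of_surjective f hf] at this

/-- A subgroup that is `σ`-subnormal in `B` (as a subgroup of the group `B`) is `σ`-subnormal in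
`B` as a subgroup of the ambient group. -/
theorem sigmaSubnormalIn_of_subgroupOf [Finite G] {A B : Subgroup G} (hAB : A ≤ B)
    (h : IsSigmaSubnormal σ (A.subgroupOf B)) : SigmaSubnormalIn σ A B := by
  have := SigmaSubnormalIn.map B.subtype (B := ⊤) h
  rwa [Subgroup.subgroupOf_map_subtype, inf_eq_left.2 hAB, ← MonoidHom.range_eq_map,
    Subgroup.range_subtype] at this

/-! ### Chief factors and `σ`-primary series -/

theorem exists_isChiefFactor [Finite G] {K : Subgroup G} (hK : K.Normal) (h : K ≠ ⊤) :
    ∃ H : Subgroup G, IsChiefFactor K H := by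
  obtain ⟨H, ⟨hH, hKH⟩, hmin⟩ := exists_minimal_of_wellFoundedLT
    (fun H : Subgroup G => H.Normal ∧ K < H) ⟨⊤, inferInstance, h.lt_top⟩
  refine ⟨H, hK, hH, hKH, fun N hN hKN hNH => ?_⟩
  rcases hKN.eq_or_lt with rfl | hlt
  · exact .inl rfl
  · exact .inr (le_antisymm hNH (hmin ⟨hN, hlt⟩ hNH))

theorem exists_isChiefFactor_bot [Finite G] [Nontrivial G] :
    ∃ R : Subgroup G, IsChiefFactor ⊥ R :=
  exists_isChiefFactor inferInstance bot_ne_top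

theorem IsChiefFactor.eq_bot_or_eq {R : Subgroup G} (h : IsChiefFactor ⊥ R) {N : Subgroup G}
    (hN : N.Normal) (hNR : N ≤ R) : N = ⊥ ∨ N = R :=
  h.2.2.2 N hN bot_le hNR

theorem IsChiefFactor.card_quotient_lt [Finite G] {R : Subgroup G} (h : IsChiefFactor ⊥ R) :
    Nat.card (G ⧸ R) < Nat.card G := by
  rw [← Subgroup.index_eq_card, ← Subgroup.index_mul_card R]
  exact lt_mul_of_one_lt_right (Nat.pos_of_ne_zero Subgroup.index_ne_zero_of_finite)
    ((Subgroup.one_lt_card_iff_ne_bot R).2 h.2.2.1.ne')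

/-- `H / K` is a `σ`-primary normal section of `G`. -/
def NormalPrimaryStep (σ : Set (Set Nat.Primes)) (K H : Subgroup G) : Prop :=
  K.Normal ∧ H.Normal ∧ K ≤ H ∧ IsPrimaryNumber σ (K.relIndex H)

/-- `G` has a normal series with `σ`-primary factors. For finite groups this is equivalent to
`σ`-solubility, and it is visibly inherited by subgroups and quotients. -/
def HasPrimarySeries (σ : Set (Set Nat.Primes)) (G : Type u) [Group G] : Prop :=
  Relation.ReflTransGen (NormalPrimaryStep σ) (⊥ : Subgroup G) ⊤

theorem IsSigmaSoluble.hasPrimarySeries [Finite G] (h : IsSigmaSoluble σ G) :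
    HasPrimarySeries σ G := by
  have key : ∀ K : Subgroup G, K.Normal →
      Relation.ReflTransGen (NormalPrimaryStep σ) K ⊤ := by
    intro K
    induction K using WellFoundedGT.induction with
    | ind K ih =>
      intro hK
      by_cases hKtop : K = ⊤
      · rw [hKtop]
      · obtain ⟨H, hH⟩ := exists_isChiefFactor hK hKtop
        exact .head ⟨hK, hH.2.1, hH.2.2.1.le, h K H hH⟩ (ih H hH.2.2.1 hH.2.1)
  exact key ⊥ inferInstance

theorem HasPrimarySeries.of_injective (h : HasPrimarySeries σ G') (f : G →* G')
    (hf : Function.Injective f) : HasPrimarySeries σ G := by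
  have := Relation.ReflTransGen.lift (p := NormalPrimaryStep σ) (Subgroup.comap f)
    (fun K H hKH => ?_) _ _ h
  · rw [HasPrimarySeries, ← Subgroup.comap_top f, ← (MonoidHom.ker_eq_bot_iff f).2 hf]
    exact this
  · obtain ⟨hK, hH, hle, s, hs, hKH⟩ := hKH
    exact ⟨hK.comap f, hH.comap f, Subgroup.comap_mono hle, s, hs,
      hKH.of_dvd (relIndex_comap_dvd f Subgroup.le_normalizer_of_normal)⟩

theorem HasPrimarySeries.of_surjective (h : HasPrimarySeries σ G) (f : G →* G')
    (hf : Function.Surjective f) : HasPrimarySeries σ G' := by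
  have := Relation.ReflTransGen.lift (p := NormalPrimaryStep σ) (Subgroup.map f)
    (fun K H hKH => ?_) _ _ h
  · rw [HasPrimarySeries, ← Subgroup.map_top_of_surjective f hf, ← Subgroup.map_bot f]
    exact this
  · obtain ⟨hK, hH, hle, s, hs, hKH⟩ := hKH
    exact ⟨hK.map f hf, hH.map f hf, Subgroup.map_mono hle, s, hs,
      hKH.of_dvd (relIndex_map_dvd f K H)⟩

theorem HasPrimarySeries.isPrimaryNumber_card [Finite G] (h : HasPrimarySeries σ G)
    {R : Subgroup G} (hR : IsChiefFactor ⊥ R) : IsPrimaryNumber σ (Nat.card R) := by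
  have hRn := hR.2.1
  -- The first member of the series that meets `R` nontrivially contains `R`.
  have key : ∀ H : Subgroup G, Relation.ReflTransGen (NormalPrimaryStep σ) ⊥ H →
      R ⊓ H = ⊥ ∨ IsPrimaryNumber σ (Nat.card R) := by
    intro H hH
    induction hH with
    | refl => exact .inl (inf_bot_eq R)
    | @tail K H _ hKH ih =>
      refine or_iff_not_imp_right.2 fun hcon => ?_
      obtain ⟨hK, hH, hle, s, hs, hsn⟩ := hKH
      have hRK := ih.resolve_right hcon
      refine (hR.eq_bot_or_eq inferInstance inf_le_left).resolve_right fun hRH => ?_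
      refine hcon ⟨s, hs, hsn.of_dvd ?_⟩
      have h1 : K.relIndex R = Nat.card R := by
        rw [← Subgroup.inf_relIndex_right, inf_comm, hRK, Subgroup.relIndex_bot_left]
      rw [← h1]
      exact relIndex_dvd_of_le_normalizer (inf_eq_left.1 hRH) Subgroup.le_normalizer_of_normal
  exact (key ⊤ h).resolve_left fun h1 => hR.2.2.1.ne' (by simpa using h1)

/-! ### Normal chains with `σ`-nilpotent factors -/

/-- `H / K` is a normal section of `G` all of whose Hall `s`-subgroups, `s ∈ σ`, are normal
(in `G`, which is no restriction as normal Hall subgroups are characteristic). This says that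
`H / K` is `σ`-nilpotent. -/
def NilpotentStep (σ : Set (Set Nat.Primes)) (K H : Subgroup G) : Prop :=
  K.Normal ∧ H.Normal ∧ K ≤ H ∧ ∀ s ∈ σ, ∃ L : Subgroup G, L.Normal ∧ K ≤ L ∧ L ≤ H ∧
    IsPiNumber s (K.relIndex L) ∧ IsPiNumber sᶜ (L.relIndex H)

/-- There is a chain of `n` steps `NilpotentStep` from `B` to the last argument. -/
def NilpotentChain (σ : Set (Set Nat.Primes)) (B : Subgroup G) : ℕ → Subgroup G → Prop
  | 0, H => H = B
  | n + 1, H => ∃ K : Subgroup G, NilpotentChain σ B n K ∧ NilpotentStep σ K H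

theorem NilpotentStep.comap (f : G →* G') {K H : Subgroup G'} (h : NilpotentStep σ K H) :
    NilpotentStep σ (K.comap f) (H.comap f) := by
  obtain ⟨hK, hH, hle, h⟩ := h
  refine ⟨hK.comap f, hH.comap f, Subgroup.comap_mono hle, fun s hs => ?_⟩
  obtain ⟨L, hL, hKL, hLH, h1, h2⟩ := h s hs
  exact ⟨L.comap f, hL.comap f, Subgroup.comap_mono hKL, Subgroup.comap_mono hLH,
    h1.of_dvd (relIndex_comap_dvd f Subgroup.le_normalizer_of_normal),
    h2.of_dvd (relIndex_comap_dvd f Subgroup.le_normalizer_of_normal)⟩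

theorem NilpotentStep.map {f : G →* G'} (hf : Function.Surjective f) {K H : Subgroup G}
    (h : NilpotentStep σ K H) : NilpotentStep σ (K.map f) (H.map f) := by
  obtain ⟨hK, hH, hle, h⟩ := h
  refine ⟨hK.map f hf, hH.map f hf, Subgroup.map_mono hle, fun s hs => ?_⟩
  obtain ⟨L, hL, hKL, hLH, h1, h2⟩ := h s hs
  exact ⟨L.map f, hL.map f hf, Subgroup.map_mono hKL, Subgroup.map_mono hLH,
    h1.of_dvd (relIndex_map_dvd f K L), h2.of_dvd (relIndex_map_dvd f L H)⟩

theorem relIndex_inf_inf_dvd {K K' L L' : Subgroup G} [K.Normal] [K'.Normal] :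
    (K ⊓ K').relIndex (L ⊓ L') ∣ K.relIndex L * K'.relIndex L' := by
  rw [← Subgroup.relIndex_inf_mul_relIndex]
  exact mul_dvd_mul
    (relIndex_dvd_of_le_normalizer (inf_le_right.trans inf_le_left)
      Subgroup.le_normalizer_of_normal)
    (relIndex_dvd_of_le_normalizer inf_le_right Subgroup.le_normalizer_of_normal)

theorem NilpotentStep.inf {K H K' H' : Subgroup G} (h : NilpotentStep σ K H)
    (h' : NilpotentStep σ K' H') : NilpotentStep σ (K ⊓ K') (H ⊓ H') := by
  obtain ⟨hK, hH, hle, h⟩ := h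
  obtain ⟨hK', hH', hle', h'⟩ := h'
  refine ⟨inferInstance, inferInstance, inf_le_inf hle hle', fun s hs => ?_⟩
  obtain ⟨L, hL, hKL, hLH, h1, h2⟩ := h s hs
  obtain ⟨L', hL', hKL', hLH', h1', h2'⟩ := h' s hs
  exact ⟨L ⊓ L', inferInstance, inf_le_inf hKL hKL', inf_le_inf hLH hLH',
    (h1.mul h1').of_dvd relIndex_inf_inf_dvd, (h2.mul h2').of_dvd relIndex_inf_inf_dvd⟩

/-- A `σ`-primary normal section is `σ`-nilpotent. -/
theorem NormalPrimaryStep.nilpotentStep (hσ : Setoid.IsPartition σ) {K H : Subgroup G}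
    (h : NormalPrimaryStep σ K H) : NilpotentStep σ K H := by
  obtain ⟨hK, hH, hle, t, ht, hn⟩ := h
  refine ⟨hK, hH, hle, fun s hs => ?_⟩
  by_cases hst : s = t
  · subst hst
    refine ⟨H, hH, hle, le_rfl, hn, ?_⟩
    rw [Subgroup.relIndex_self]
    exact isPiNumber_one _
  · refine ⟨K, hK, le_rfl, hle, ?_, hn.compl_of_ne hσ hs ht hst⟩
    rw [Subgroup.relIndex_self]
    exact isPiNumber_one _

theorem NilpotentChain.comap (f : G →* G') {B : Subgroup G'} {n : ℕ} {H : Subgroup G'}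
    (h : NilpotentChain σ B n H) : NilpotentChain σ (B.comap f) n (H.comap f) := by
  induction n generalizing H with
  | zero => exact congrArg _ h
  | succ n ih =>
    obtain ⟨K, hK, hKH⟩ := h
    exact ⟨K.comap f, ih hK, hKH.comap f⟩

theorem NilpotentChain.map {f : G →* G'} (hf : Function.Surjective f) {B : Subgroup G} {n : ℕ}
    {H : Subgroup G} (h : NilpotentChain σ B n H) :
    NilpotentChain σ (B.map f) n (H.map f) := by
  induction n generalizing H with
  | zero => exact congrArg _ h
  | succ n ih =>
    obtain ⟨K, hK, hKH⟩ := h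
    exact ⟨K.map f, ih hK, hKH.map hf⟩

theorem NilpotentChain.inf {B B' : Subgroup G} {n : ℕ} {H H' : Subgroup G}
    (h : NilpotentChain σ B n H) (h' : NilpotentChain σ B' n H') :
    NilpotentChain σ (B ⊓ B') n (H ⊓ H') := by
  induction n generalizing H H' with
  | zero => exact congrArg₂ _ h h'
  | succ n ih =>
    obtain ⟨K, hK, hKH⟩ := h
    obtain ⟨K', hK', hKH'⟩ := h'
    exact ⟨K ⊓ K', ih hK hK', hKH.inf hKH'⟩

theorem NilpotentChain.cons {B B' : Subgroup G} {n : ℕ} {H : Subgroup G}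
    (hB : NilpotentStep σ B B') (h : NilpotentChain σ B' n H) :
    NilpotentChain σ B (n + 1) H := by
  induction n generalizing H with
  | zero =>
    obtain rfl : H = B' := h
    exact ⟨B, rfl, hB⟩
  | succ n ih =>
    obtain ⟨K, hK, hKH⟩ := h
    exact ⟨K, ih hK, hKH⟩

theorem NilpotentChain.exists_first {B : Subgroup G} {n : ℕ} {H : Subgroup G}
    (h : NilpotentChain σ B (n + 1) H) :
    ∃ B', NilpotentStep σ B B' ∧ NilpotentChain σ B' n H := by
  induction n generalizing H with
  | zero =>
    obtain ⟨K, rfl, hKH⟩ := h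
    exact ⟨H, hKH, rfl⟩
  | succ n ih =>
    obtain ⟨K, hK, hKH⟩ := h
    obtain ⟨B', hB, hB'⟩ := ih hK
    exact ⟨B', hB, K, hB', hKH⟩

theorem nilpotentChain_one {B H : Subgroup G} : NilpotentChain σ B 1 H ↔ NilpotentStep σ B H :=
  ⟨fun ⟨_, hK, h⟩ => hK ▸ h, fun h => ⟨B, rfl, h⟩⟩

theorem finite_sigmaOf (hσ : Setoid.IsPartition σ) {n : ℕ} (hn : n ≠ 0) :
    (sigmaOf σ n).Finite := by
  have hfin : {p : Nat.Primes | (p : ℕ) ∣ n}.Finite :=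
    Set.Finite.of_injOn (f := fun p : Nat.Primes => (p : ℕ)) (t := {k | k ∣ n})
      (fun p hp => hp) (fun p _ q _ h => Subtype.ext h)
      ((Set.finite_le_nat n).subset fun k hk => Nat.le_of_dvd (Nat.pos_of_ne_zero hn) hk)
  refine (hfin.image fun p => (hσ.2 p).choose).subset ?_
  rintro s ⟨hs, p, hps, hpn⟩
  exact ⟨p, hpn, ((hσ.2 p).choose_spec.2 s ⟨hs, hps⟩).symm⟩

/-- A finite group with a normal Hall `s`-subgroup for each `s ∈ σ` is the direct product of
these subgroups. -/
theorem isSigmaNilpotent_of_normal_hall [Finite G] (hσ : Setoid.IsPartition σ)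
    (h : ∀ s ∈ σ, ∃ N : Subgroup G, N.Normal ∧ IsHall s N) : IsSigmaNilpotent σ G := by
  classical
  choose N hN hHall using h
  have : Finite (sigmaOf σ (Nat.card G)) := finite_sigmaOf hσ Nat.card_pos.ne'
  let e := Finite.equivFin (sigmaOf σ (Nat.card G))
  let A : Fin (Nat.card (sigmaOf σ (Nat.card G))) → Subgroup G :=
    fun i => N (e.symm i).1 (e.symm i).2.1
  have hcop : ∀ i j, i ≠ j → (Nat.card (A i)).Coprime (Nat.card (A j)) := fun i j hij =>
    (hHall _ (e.symm i).2.1).1.coprime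
      ((hHall _ (e.symm j).2.1).1.compl_of_ne hσ (e.symm i).2.1 (e.symm j).2.1
        fun h => hij (e.symm.injective (Subtype.ext h)))
  refine ⟨_, A, fun i => hN _ _, ?_, ?_, fun i => ⟨_, (e.symm i).2.1, (hHall _ _).1⟩⟩
  · have : ∀ i, Fintype (A i) := fun i => Fintype.ofFinite _
    refine Subgroup.independent_of_coprime_order (fun i j hij x y hx hy => ?_)
      fun i j hij => ?_
    · exact Subgroup.commute_of_normal_of_disjoint _ _ (hN _ _) (hN _ _)
        (Subgroup.disjoint_of_coprime_natCard (hcop i j hij)) x y hx hy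
    · simpa [Nat.card_eq_fintype_card] using hcop i j hij
  · rw [← Subgroup.index_eq_one]
    by_contra hne
    obtain ⟨p, hp, hpd⟩ := Nat.exists_prime_and_dvd hne
    obtain ⟨s, hs, hps⟩ := (hσ.2 ⟨p, hp⟩).exists
    have hmem : s ∈ sigmaOf σ (Nat.card G) :=
      ⟨hs, ⟨p, hp⟩, hps, hpd.trans (Subgroup.index_dvd_card _)⟩
    have hle : N s hs ≤ ⨆ i, A i := by
      have hA : A (e ⟨s, hmem⟩) = N s hs :=
        congrArg (fun t : sigmaOf σ (Nat.card G) => N t.1 t.2.1) (e.symm_apply_apply ⟨s, hmem⟩)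
      exact hA ▸ le_iSup A (e ⟨s, hmem⟩)
    exact (hHall s hs).2 ⟨p, hp⟩ (hpd.trans (Subgroup.index_dvd_of_le hle)) hps

theorem NilpotentStep.isSigmaNilpotent [Finite G] (hσ : Setoid.IsPartition σ)
    {K H : Subgroup G} (h : NilpotentStep σ K H) :
    ∃ _ : (K.subgroupOf H).Normal, IsSigmaNilpotent σ (H ⧸ K.subgroupOf H) := by
  obtain ⟨hK, hH, hle, h⟩ := h
  refine ⟨inferInstance, isSigmaNilpotent_of_normal_hall hσ fun s hs => ?_⟩
  obtain ⟨L, hL, hKL, hLH, h1, h2⟩ := h s hs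
  have hsurj := QuotientGroup.mk'_surjective (K.subgroupOf H)
  refine ⟨(L.subgroupOf H).map (QuotientGroup.mk' (K.subgroupOf H)),
    Subgroup.Normal.map inferInstance _ hsurj, ?_, ?_⟩
  · rwa [← Subgroup.relIndex_ker, QuotientGroup.ker_mk', Subgroup.relIndex_subgroupOf hLH]
  · rwa [Subgroup.index_map_eq _ hsurj]
    rw [QuotientGroup.ker_mk']
    exact Subgroup.comap_mono hKL

theorem NilpotentStep.isSigmaNilpotent_of_bot_top [Finite G] (hσ : Setoid.IsPartition σ)
    (h : NilpotentStep σ (⊥ : Subgroup G) ⊤) : IsSigmaNilpotent σ G := by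
  refine isSigmaNilpotent_of_normal_hall hσ fun s hs => ?_
  obtain ⟨L, hL, -, -, h1, h2⟩ := h.2.2.2 s hs
  exact ⟨L, hL, by rwa [Subgroup.relIndex_bot_left] at h1,
    by rwa [Subgroup.relIndex_top_right] at h2⟩

theorem NilpotentChain.exists_seq {B : Subgroup G} {n : ℕ} {H : Subgroup G}
    (h : NilpotentChain σ B n H) : ∃ c : ℕ → Subgroup G, c 0 = B ∧ c n = H ∧
      ∀ i < n, NilpotentStep σ (c i) (c (i + 1)) := by
  induction n generalizing H with
  | zero => exact ⟨fun _ => B, rfl, h.symm, fun i hi => absurd hi (Nat.not_lt_zero i)⟩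
  | succ n ih =>
    obtain ⟨K, hK, hKH⟩ := h
    obtain ⟨c, h0, hn, hc⟩ := ih hK
    refine ⟨Function.update c (n + 1) H, by simpa [Function.update] using h0, by simp,
      fun i hi => ?_⟩
    rw [Function.update_of_ne (by omega)]
    rcases (Nat.lt_succ_iff.1 hi).eq_or_lt with rfl | hi
    · rw [Function.update_self, hn]
      exact hKH
    · rw [Function.update_of_ne (by omega)]
      exact hc i hi

theorem NilpotentChain.hasSigmaNilpotentChain [Finite G] (hσ : Setoid.IsPartition σ) {n : ℕ}
    (h : NilpotentChain σ (⊥ : Subgroup G) n ⊤) : HasSigmaNilpotentChain σ G n := by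
  obtain ⟨c, h0, hn, hc⟩ := h.exists_seq
  have hnorm : ∀ i : Fin (n + 1), (c i).Normal := by
    rintro ⟨_ | i, hi⟩
    · rw [h0]
      infer_instance
    · exact (hc i (by omega)).2.1
  refine ⟨fun i => c i, hnorm, h0, hn, fun i => ⟨(hc i i.2).2.2.1, ?_⟩⟩
  exact ((hc i i.2).isSigmaNilpotent hσ).2

/-! ### Complements of abelian normal Hall subgroups -/

/-- Conjugacy in the Schur-Zassenhaus theorem, for an abelian normal subgroup. A complement is
the stabilizer of the point that it defines in Mathlib's `Subgroup.QuotientDiff`, on which the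
normal subgroup acts transitively. -/
theorem exists_map_conj_eq_of_isComplement' [Finite G] {H : Subgroup G} [H.Normal]
    [IsMulCommutative H] (hH : (Nat.card H).Coprime H.index) {K K' : Subgroup G}
    (hK : H.IsComplement' K) (hK' : H.IsComplement' K') :
    ∃ h ∈ H, K' = K.map (MulAut.conj h).toMonoidHom := by
  have key : ∀ K : Subgroup G, H.IsComplement' K →
      ∃ α : H.QuotientDiff, K = MulAction.stabilizer G α := by
    intro K hK
    refine ⟨Quotient.mk'' ⟨(K : Set G), hK.symm⟩, ?_⟩
    refine Subgroup.eq_of_le_of_card_ge (fun k hk => ?_) ?_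
    · refine congrArg Quotient.mk'' (Subtype.ext ?_)
      ext x
      change x ∈ MulOpposite.op k⁻¹ • (K : Set G) ↔ x ∈ K
      rw [Set.mem_smul_set_iff_inv_smul_mem]
      simp [K.mul_mem_cancel_right hk]
    · exact ((Subgroup.isComplement'_stabilizer_of_coprime hH).symm.index_eq_card.symm.trans
        hK.symm.index_eq_card).le
  obtain ⟨α, rfl⟩ := key K hK
  obtain ⟨β, rfl⟩ := key K' hK'
  obtain ⟨h, rfl⟩ := Subgroup.exists_smul_eq hH α β
  exact ⟨h, h.2, MulAction.stabilizer_smul_eq_stabilizer_map_conj (h : G) α⟩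

/-- A Frattini argument: the conjugates in `G` of a complement of `R` in `L` are conjugate under
`R`, so `G` is the product of `R` with the normalizer of the complement. -/
theorem exists_normal_complement_of_le_frattini [Finite G] {R L : Subgroup G} [R.Normal]
    [L.Normal] [IsMulCommutative R] (hRL : R ≤ L)
    (hcop : (Nat.card R).Coprime (R.relIndex L)) (hR : R ≤ frattini G) :
    ∃ K : Subgroup G, K.Normal ∧ K ≤ L ∧ Nat.card K = R.relIndex L ∧
      K.relIndex L = Nat.card R := by
  have hcard : Nat.card (R.subgroupOf L) = Nat.card R :=
    Nat.card_congr (Subgroup.subgroupOfEquivOfLe hRL).toEquiv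
  have hcop' : (Nat.card (R.subgroupOf L)).Coprime (R.subgroupOf L).index := by
    rwa [hcard]
  have : IsMulCommutative (R.subgroupOf L) := inferInstance
  obtain ⟨K, hK⟩ := Subgroup.exists_right_complement'_of_coprime hcop'
  have hKcard : Nat.card (K.map L.subtype) = Nat.card K :=
    Subgroup.card_map_of_injective L.subtype_injective
  refine ⟨K.map L.subtype, ?_, Subgroup.map_subtype_le K, ?_, ?_⟩
  · rw [← Subgroup.normalizer_eq_top_iff]
    refine frattini_nongenerating (top_le_iff.1 fun g _ => ?_)
    have hK' : (R.subgroupOf L).IsComplement' (K.map (MulAut.conjNormal g).toMonoidHom) := by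
      have hc : Nat.card (K.map (MulAut.conjNormal g).toMonoidHom) = Nat.card K :=
        Nat.card_congr
          (K.equivMapOfInjective _ (MulAut.conjNormal g).injective).symm.toEquiv
      refine Subgroup.isComplement'_of_coprime (by rw [hc, hK.card_mul_card]) ?_
      rwa [hc, ← hK.symm.index_eq_card]
    obtain ⟨r, hr, hrK⟩ := exists_map_conj_eq_of_isComplement' hcop' hK hK'
    have hmem : ((r : G)⁻¹ * g) ∈ Subgroup.normalizer ((K.map L.subtype : Subgroup G) : Set G) := by
      have hmap : ∀ x : L, x ∈ K ↔ r⁻¹ * MulAut.conjNormal g x * r ∈ K := fun x => by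
        have h1 : MulAut.conjNormal g x ∈ K.map (MulAut.conjNormal g).toMonoidHom ↔ x ∈ K :=
          Subgroup.mem_map_iff_mem (MulAut.conjNormal g).injective
        rw [← h1, hrK]
        refine (Subgroup.mem_map_equiv (f := MulAut.conj r)).trans ?_
        rw [MulAut.conj_symm_apply]
      rw [Subgroup.mem_normalizer_iff]
      intro x
      by_cases hx : x ∈ L
      · have h1 : ∀ y : L, (y : G) ∈ K.map L.subtype ↔ y ∈ K := fun y =>
          Subgroup.mem_map_iff_mem L.subtype_injective
        have h2 : (r : G)⁻¹ * g * x * ((r : G)⁻¹ * g)⁻¹ =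
            ((r⁻¹ * MulAut.conjNormal g ⟨x, hx⟩ * r : L) : G) := by
          simp [mul_assoc]
        rw [h2, h1, ← hmap, ← h1]
      · refine iff_of_false (fun h => hx (Subgroup.map_subtype_le K h)) fun h => hx ?_
        have h1 := Subgroup.map_subtype_le K h
        have h2 : (r : G)⁻¹ * g * x * ((r : G)⁻¹ * g)⁻¹ =
            (r : G)⁻¹ * (g * x * g⁻¹) * r := by group
        rw [h2, L.mul_mem_cancel_right r.2, L.mul_mem_cancel_left (inv_mem r.2)] at h1
        simpa [mul_assoc] using ‹L.Normal›.conj_mem _ h1 g⁻¹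
    rw [show g = (r : G) * ((r : G)⁻¹ * g) by group]
    exact mul_mem (Subgroup.mem_sup_right (hR hr)) (Subgroup.mem_sup_left hmem)
  · rw [hKcard, ← hK.symm.index_eq_card]
    rfl
  · rw [Subgroup.relIndex, Subgroup.subgroupOf,
      Subgroup.comap_map_eq_self_of_injective L.subtype_injective, hK.index_eq_card, hcard]

theorem IsChiefFactor.isMulCommutative {R : Subgroup G} (h : IsChiefFactor ⊥ R)
    (hs : Group.IsSolvable R) : IsMulCommutative R := by
  have := h.2.1
  have hnt : Nontrivial R := R.nontrivial_iff_ne_bot.2 h.2.2.1.ne'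
  rcases h.eq_bot_or_eq (N := ⁅R, R⁆) inferInstance (Subgroup.commutator_le_left R R) with h1 | h1
  · rw [Subgroup.commutator_eq_bot_iff_le_centralizer] at h1
    exact ⟨⟨fun a b => Subtype.ext (h1 b.2 a a.2)⟩⟩
  · refine absurd ?_ (Group.IsSolvable.commutator_lt_top_of_nontrivial R).ne
    refine Subgroup.map_injective R.subtype_injective ?_
    rw [Subgroup.map_subtype_commutator, h1, ← MonoidHom.range_eq_map, Subgroup.range_subtype]

/-- Gaschütz's theorem for `σ`-nilpotency: a normal subgroup `H` that is `σ`-nilpotent modulo a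
minimal normal subgroup `R` inside the Frattini subgroup is `σ`-nilpotent. -/
theorem NilpotentStep.bot_of_le_frattini [Finite G] (hσ : Setoid.IsPartition σ)
    {R H : Subgroup G} (hR : IsChiefFactor ⊥ R) (hRp : IsPrimaryNumber σ (Nat.card R))
    (hRF : R ≤ frattini G) (h : NilpotentStep σ R H) : NilpotentStep σ ⊥ H := by
  obtain ⟨hRn, hH, hle, h⟩ := h
  have : Group.IsNilpotent (frattini G) := frattini_nilpotent
  have : Group.IsSolvable R :=
    Group.isSolvable_of_isSolvable_injective (Subgroup.inclusion_injective hRF)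
  have := hR.isMulCommutative this
  obtain ⟨t, ht, htR⟩ := hRp
  refine ⟨inferInstance, hH, bot_le, fun s hs => ?_⟩
  obtain ⟨L, hL, hRL, hLH, h1, h2⟩ := h s hs
  by_cases hst : s = t
  · subst hst
    refine ⟨L, hL, bot_le, hLH, ?_, h2⟩
    rw [← Subgroup.relIndex_mul_relIndex ⊥ R L bot_le hRL, Subgroup.relIndex_bot_left]
    exact htR.mul h1
  · have htR' := htR.compl_of_ne hσ hs ht hst
    obtain ⟨K, hK, hKL, hKc, hKi⟩ :=
      exists_normal_complement_of_le_frattini hRL (h1.coprime htR').symm hRF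
    refine ⟨K, hK, bot_le, hKL.trans hLH, ?_, ?_⟩
    · rwa [Subgroup.relIndex_bot_left, hKc]
    · rw [← Subgroup.relIndex_mul_relIndex K L H hKL hLH, hKi]
      exact htR'.mul h2

/-! ### `n`-maximal subgroups -/

theorem covBy_comap {f : G →* G'} (hf : Function.Surjective f) {A B : Subgroup G'}
    (h : A ⋖ B) : A.comap f ⋖ B.comap f := by
  refine ⟨(Subgroup.comap_lt_comap_of_surjective hf).2 h.lt, fun C hAC hCB => ?_⟩
  have hC : (C.map f).comap f = C :=
    Subgroup.comap_map_eq_self ((MonoidHom.ker_le_comap f A).trans hAC.le)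
  rw [← hC, Subgroup.comap_lt_comap_of_surjective hf] at hAC hCB
  exact h.2 hAC hCB

theorem covBy_map_subtype {M : Subgroup G} {A B : Subgroup M} (h : A ⋖ B) :
    A.map M.subtype ⋖ B.map M.subtype := by
  have hinj := Subgroup.map_injective M.subtype_injective
  have hmono : ∀ {A B : Subgroup M}, A.map M.subtype < B.map M.subtype ↔ A < B := fun {A B} => by
    simp only [lt_iff_le_not_ge, Subgroup.map_subtype_le_map_subtype]
  refine ⟨hmono.2 h.lt, fun C hAC hCB => ?_⟩
  have hC : (C.subgroupOf M).map M.subtype = C := by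
    rw [Subgroup.subgroupOf_map_subtype, inf_eq_left]
    exact hCB.le.trans (Subgroup.map_subtype_le B)
  rw [← hC, hmono] at hAC hCB
  exact h.2 hAC hCB

theorem IsNMaximal.comap {f : G →* G'} (hf : Function.Surjective f) {n : ℕ} {H : Subgroup G'}
    (h : IsNMaximal n H) : IsNMaximal n (H.comap f) := by
  induction n generalizing H with
  | zero =>
    obtain rfl : H = ⊤ := h
    exact Subgroup.comap_top f
  | succ n ih =>
    obtain ⟨M, hM, hHM⟩ := h
    exact ⟨M.comap f, ih hM, covBy_comap hf hHM⟩

theorem IsNMaximal.map_subtype {a m : ℕ} {M : Subgroup G} (hM : IsNMaximal a M)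
    {H : Subgroup M} (h : IsNMaximal m H) : IsNMaximal (a + m) (H.map M.subtype) := by
  induction m generalizing H with
  | zero =>
    obtain rfl : H = ⊤ := h
    rwa [← MonoidHom.range_eq_map, Subgroup.range_subtype]
  | succ m ih =>
    obtain ⟨K, hK, hHK⟩ := h
    exact ⟨K.map M.subtype, ih hK, covBy_map_subtype hHK⟩

theorem IsNMaximal.of_isCoatom {M : Subgroup G} (h : IsCoatom M) : IsNMaximal 1 M :=
  ⟨⊤, rfl, covBy_top_iff.2 h⟩

theorem prime_index_of_normal_of_isCoatom [Finite G] {M : Subgroup G} (hn : M.Normal)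
    (hM : IsCoatom M) : M.index.Prime := by
  obtain ⟨p, hp, hpd⟩ := Nat.exists_prime_and_dvd (Subgroup.index_eq_one.not.2 hM.1)
  have : Fact p.Prime := ⟨hp⟩
  rw [Subgroup.index_eq_card] at hpd ⊢
  obtain ⟨x, hx⟩ := exists_prime_orderOf_dvd_card' p hpd
  have hsurj := QuotientGroup.mk'_surjective M
  have h1 : (Subgroup.zpowers x).comap (QuotientGroup.mk' M) = ⊤ := by
    refine hM.2 _ (lt_of_le_of_ne (QuotientGroup.le_comap_mk' M _) fun h => ?_)
    have h2 := congrArg (Subgroup.map (QuotientGroup.mk' M)) h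
    rw [Subgroup.map_comap_eq_self_of_surjective hsurj, QuotientGroup.map_mk'_self,
      eq_comm, Subgroup.zpowers_eq_bot] at h2
    rw [h2, orderOf_one] at hx
    exact hp.one_lt.ne hx
  have h2 : Subgroup.zpowers x = ⊤ :=
    Subgroup.comap_injective hsurj (by rw [h1, Subgroup.comap_top])
  rwa [← Subgroup.card_top, ← h2, Nat.card_zpowers, hx]

theorem isPrimaryNumber_of_prime (hσ : Setoid.IsPartition σ) {p : ℕ} (hp : p.Prime) :
    IsPrimaryNumber σ p := by
  obtain ⟨s, hs, hps⟩ := (hσ.2 ⟨p, hp⟩).exists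
  exact ⟨s, hs, by simpa using IsPiNumber.pow hps 1⟩

theorem IsSigmaSubnormal.exists_normal_le_of_isCoatom [Finite G] (hσ : Setoid.IsPartition σ)
    {M : Subgroup G} (h : IsSigmaSubnormal σ M) (hM : IsCoatom M) :
    ∃ N ≤ M, N.Normal ∧ IsPrimaryNumber σ N.index := by
  revert hM
  induction h using Relation.ReflTransGen.head_induction_on with
  | refl => exact fun hM => absurd rfl hM.1
  | @head A C hAC _ ih =>
    intro hM
    rw [sigmaSubnormalStep_iff] at hAC
    rcases hM.le_iff.1 hAC.1 with rfl | rfl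
    · rcases hAC.2 with h | ⟨s, hs, N, hNA, hN, h⟩
      · have hn : A.Normal := Subgroup.normalizer_eq_top_iff.1 (top_le_iff.1 h)
        exact ⟨A, le_rfl, hn, isPrimaryNumber_of_prime hσ (prime_index_of_normal_of_isCoatom hn hM)⟩
      · refine ⟨N, hNA, Subgroup.normalizer_eq_top_iff.1 (top_le_iff.1 hN), s, hs, ?_⟩
        rwa [Subgroup.relIndex_top_right] at h
    · exact ih hM

/-! ### The `σ`-nilpotent length -/

/-- If all `n`-maximal subgroups of `G` are `σ`-subnormal, then `G` has a normal chain of length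
`n` with `σ`-nilpotent factors. For `n = 1` this says that `G` is `σ`-nilpotent as soon as its
maximal subgroups are `σ`-subnormal.

The proof is by induction on the order of `G`, for a minimal normal subgroup `R`. If `R` lies in
the Frattini subgroup, the chain of `G ⧸ R` can be lifted. Otherwise `G = M R` for a maximal
subgroup `M`, whose `(n - 1)`-maximal subgroups are `σ`-subnormal. -/
theorem nilpotentChain_of_isSigmaSubnormal (hσ : Setoid.IsPartition σ) (G : Type u) [Group G]
    [Finite G] (hG : HasPrimarySeries σ G) {n : ℕ} (hn : 0 < n)
    (h : ∀ H : Subgroup G, IsNMaximal n H → IsSigmaSubnormal σ H) :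
    NilpotentChain σ (⊥ : Subgroup G) n ⊤ := by
  induction hk : Nat.card G using Nat.strong_induction_on generalizing G n with
  | _ k ih =>
  obtain ⟨m, rfl⟩ := Nat.exists_eq_add_one.2 hn
  by_cases hnt : Nontrivial G
  swap
  · rw [not_nontrivial_iff_subsingleton] at hnt
    have h1 : NilpotentStep σ (⊥ : Subgroup G) ⊥ := by
      obtain ⟨p, hp⟩ := Nat.exists_infinite_primes 0
      refine NormalPrimaryStep.nilpotentStep hσ ⟨inferInstance, inferInstance, le_rfl, ?_⟩
      obtain ⟨s, hs, -⟩ := isPrimaryNumber_of_prime hσ hp.2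
      exact ⟨s, hs, by simpa using isPiNumber_one s⟩
    have h2 : ∀ j, NilpotentChain σ (⊥ : Subgroup G) j ⊥ := fun j => by
      induction j with
      | zero => exact rfl
      | succ j ihj => exact ⟨⊥, ihj, h1⟩
    rw [Subsingleton.elim (⊤ : Subgroup G) ⊥]
    exact h2 _
  obtain ⟨R, hR⟩ := exists_isChiefFactor_bot (G := G)
  have hRn := hR.2.1
  have hRp := hG.isPrimaryNumber_card hR
  have hsurj := QuotientGroup.mk'_surjective R
  have hquot : NilpotentChain σ R (m + 1) ⊤ := by
    have hlt : Nat.card (G ⧸ R) < k := hk ▸ hR.card_quotient_lt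
    have := ih _ hlt (G ⧸ R) (hG.of_surjective _ hsurj) (n := m + 1) hn (fun H hH => by
      have := (h _ (hH.comap hsurj)).map hsurj
      rwa [Subgroup.map_comap_eq_self_of_surjective hsurj] at this) rfl
    have h1 := this.comap (QuotientGroup.mk' R)
    rwa [MonoidHom.comap_bot, QuotientGroup.ker_mk', Subgroup.comap_top] at h1
  by_cases hRF : R ≤ frattini G
  · obtain ⟨B, hB, hchain⟩ := hquot.exists_first
    exact hchain.cons (hB.bot_of_le_frattini hσ hR hRp hRF)
  obtain ⟨M, hM, hRM⟩ : ∃ M : Subgroup G, IsCoatom M ∧ ¬ R ≤ M := by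
    by_contra! hcon
    exact hRF (le_iInf₂ fun M hM => hcon M hM)
  rcases m.eq_zero_or_pos with rfl | hm
  · obtain ⟨N, hNM, hN, hNp⟩ :=
      (h M (.of_isCoatom hM)).exists_normal_le_of_isCoatom hσ hM
    have h1 : NilpotentChain σ N 1 ⊤ := nilpotentChain_one.2
      (NormalPrimaryStep.nilpotentStep hσ ⟨hN, inferInstance, le_top, by simpa using hNp⟩)
    have h2 : R ⊓ N = ⊥ := (hR.eq_bot_or_eq inferInstance inf_le_left).resolve_right fun h =>
      hRM ((inf_eq_left.1 h).trans hNM)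
    simpa [h2] using hquot.inf h1
  · have hlt : Nat.card M < k := by
      rw [← hk]
      exact (Subgroup.card_le_card_group M).lt_of_ne fun h => hM.1 (Subgroup.eq_top_of_card_eq M h)
    have hchain := ih _ hlt M (hG.of_injective _ M.subtype_injective) hm (fun H hH => by
      have := isSigmaSubnormal_subgroupOf
        (h _ (Nat.add_comm 1 m ▸ (IsNMaximal.of_isCoatom hM).map_subtype hH)) M
      rwa [Subgroup.subgroupOf, Subgroup.comap_map_eq_self_of_injective M.subtype_injective]
        at this) rfl
    have hMR : M ⊔ R = ⊤ := hM.2 _ (lt_of_le_of_ne le_sup_left fun h => hRM (h ▸ le_sup_right))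
    have hMsurj : Function.Surjective ((QuotientGroup.mk' R).comp M.subtype) := by
      rw [← MonoidHom.range_eq_top, MonoidHom.range_comp, Subgroup.range_subtype]
      have := Subgroup.map_sup M R (QuotientGroup.mk' R)
      rwa [hMR, Subgroup.map_top_of_surjective _ hsurj, QuotientGroup.map_mk'_self, sup_bot_eq,
        eq_comm] at this
    have h1 := (hchain.map hMsurj).comap (QuotientGroup.mk' R)
    rw [Subgroup.map_bot, MonoidHom.comap_bot, QuotientGroup.ker_mk',
      Subgroup.map_top_of_surjective _ hMsurj, Subgroup.comap_top] at h1
    exact h1.cons (NormalPrimaryStep.nilpotentStep hσ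
      ⟨inferInstance, hRn, bot_le, by simpa using hRp⟩)

/-! ### Products of permuting subgroups -/

theorem coe_sup_of_mul_comm {V E : Subgroup G} (h : (V : Set G) * E = E * V) :
    ((V ⊔ E : Subgroup G) : Set G) = E * V := by
  let W : Subgroup G :=
    { carrier := (E : Set G) * V
      mul_mem' := fun {a b} ha hb => by
        have h1 : (E : Set G) * V * (E * V) = E * V := by
          rw [mul_assoc, ← mul_assoc (V : Set G), h, mul_assoc, coe_mul_coe, ← mul_assoc,
            coe_mul_coe]
        rw [← h1]
        exact Set.mul_mem_mul ha hb
      one_mem' := ⟨1, one_mem E, 1, one_mem V, one_mul 1⟩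
      inv_mem' := fun {a} ⟨e, he, v, hv, hev⟩ => by
        rw [← h, ← hev, mul_inv_rev]
        exact Set.mul_mem_mul (inv_mem hv) (inv_mem he) }
  refine subset_antisymm ?_ ?_
  · have hVW : V ≤ W := fun v hv => ⟨1, one_mem E, v, hv, one_mul v⟩
    have hEW : E ≤ W := fun e he => ⟨e, he, 1, one_mem V, mul_one e⟩
    exact sup_le hVW hEW
  · rintro _ ⟨e, he, v, hv, rfl⟩
    exact mul_mem (Subgroup.mem_sup_right he) (Subgroup.mem_sup_left hv)

theorem relIndex_sup_of_mul_comm {V E : Subgroup G} (h : (V : Set G) * E = E * V) :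
    V.relIndex (V ⊔ E) = V.relIndex E := by
  refine (Nat.card_congr (Equiv.ofBijective
    (Subgroup.quotientSubgroupOfEmbeddingOfLE V (le_sup_right : E ≤ V ⊔ E))
    ⟨(Subgroup.quotientSubgroupOfEmbeddingOfLE V _).injective, fun w => ?_⟩)).symm
  induction w using QuotientGroup.induction_on with
  | H w =>
    have hw : (w : G) ∈ (E : Set G) * V := by
      rw [← coe_sup_of_mul_comm h]
      exact w.2
    obtain ⟨e, he, v, hv, hev⟩ := hw
    refine ⟨QuotientGroup.mk ⟨e, he⟩, ?_⟩
    rw [Subgroup.quotientSubgroupOfEmbeddingOfLE_apply_mk, QuotientGroup.eq,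
      Subgroup.mem_subgroupOf]
    have h1 : (((Subgroup.inclusion le_sup_right ⟨e, he⟩ : ↥(V ⊔ E))⁻¹ * w : ↥(V ⊔ E)) : G) = v := by
      rw [Subgroup.coe_mul, ← hev]
      simp
    rw [h1]
    exact hv

theorem card_sup_of_mul_comm [Finite G] {V E : Subgroup G} (h : (V : Set G) * E = E * V)
    (hVE : V ⊓ E = ⊥) : Nat.card ↥(V ⊔ E) = Nat.card V * Nat.card E := by
  have h1 := relIndex_sup_of_mul_comm h
  rw [← Subgroup.inf_relIndex_right V E, hVE, Subgroup.relIndex_bot_left] at h1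
  rw [← h1, ← Subgroup.relIndex_bot_left V,
    Subgroup.relIndex_mul_relIndex _ _ _ bot_le le_sup_left, Subgroup.relIndex_bot_left]

theorem relIndex_sup_eq_of_normal (S N : Subgroup G) [N.Normal] :
    S.relIndex (S ⊔ N) = S.relIndex N :=
  relIndex_sup_of_mul_comm (Subgroup.set_mul_normal_comm _ N)

theorem relIndex_dvd_index_of_normal_right (S N : Subgroup G) [N.Normal] :
    S.relIndex N ∣ S.index := by
  rw [← relIndex_sup_eq_of_normal]
  exact Subgroup.relIndex_dvd_index_of_le le_sup_left

/-! ### Hall subgroups and `σ`-subnormality -/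

theorem IsHall.map [Finite G] {s : Set Nat.Primes} {S : Subgroup G} (h : IsHall s S)
    {f : G →* G'} (hf : Function.Surjective f) : IsHall s (S.map f) :=
  ⟨h.1.of_dvd (Subgroup.card_map_dvd S f), h.2.of_dvd (Subgroup.index_map_dvd S hf)⟩

theorem SigmaSubnormalStep.isPiNumber_compl_relIndex [Finite G] (hσ : Setoid.IsPartition σ)
    {s : Set Nat.Primes} (hs : s ∈ σ) {A B S : Subgroup G} (h : SigmaSubnormalStep σ A B)
    (hS : IsPiNumber sᶜ (S.relIndex B)) : IsPiNumber sᶜ (S.relIndex A) := by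
  obtain ⟨hAB, h⟩ := sigmaSubnormalStep_iff.1 h
  -- The relative index of `S` in a subgroup of `B` that is normal in `B` divides that in `B`.
  have key : ∀ N ≤ B, B ≤ Subgroup.normalizer (N : Set G) → S.relIndex N ∣ S.relIndex B := by
    intro N hNB hN
    have : (N.subgroupOf B).Normal := Subgroup.normal_subgroupOf_of_le_normalizer hN
    rw [← Subgroup.relIndex_subgroupOf hNB]
    exact relIndex_dvd_index_of_normal_right _ _
  rcases h with h | ⟨t, ht, N, hNA, hBN, hN⟩
  · exact hS.of_dvd (key A hAB h)
  have hSN := hS.of_dvd (key N (hNA.trans hAB) hBN)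
  by_cases hst : s = t
  · -- Here `B = N (S ⊓ B)`, hence `A = N (S ⊓ A)` and the index of `S ⊓ A` in `A` is that of
    -- `S ⊓ N` in `N`.
    subst hst
    have : (N.subgroupOf B).Normal := Subgroup.normal_subgroupOf_of_le_normalizer hBN
    have : (N.subgroupOf A).Normal :=
      Subgroup.normal_subgroupOf_of_le_normalizer (hAB.trans hBN)
    have htop : S.subgroupOf B ⊔ N.subgroupOf B = ⊤ := by
      rw [← Subgroup.index_eq_one]
      exact Nat.eq_one_of_dvd_coprimes (hN.coprime hS)
        (Subgroup.index_dvd_of_le le_sup_right) (Subgroup.index_dvd_of_le le_sup_left)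
    have htop' : S.subgroupOf A ⊔ N.subgroupOf A = ⊤ := by
      refine top_le_iff.1 fun a _ => ?_
      have ha : (⟨a, hAB a.2⟩ : B) ∈ S.subgroupOf B ⊔ N.subgroupOf B := by
        rw [htop]
        trivial
      obtain ⟨x, hx, n, hn, hxn⟩ := Subgroup.mem_sup_of_normal_right.1 ha
      have hn' : (n : G) ∈ N := hn
      have hxn' : (x : G) * n = a := congrArg Subtype.val hxn
      have hxA : (x : G) ∈ A := by
        rw [← A.mul_mem_cancel_right (hNA hn'), hxn']
        exact a.2
      have ha' : a = ⟨x, hxA⟩ * ⟨n, hNA hn'⟩ := Subtype.ext hxn'.symm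
      rw [ha']
      exact Subgroup.mul_mem_sup (show (x : G) ∈ S from hx) hn'
    have h1 := relIndex_sup_eq_of_normal (S.subgroupOf A) (N.subgroupOf A)
    rw [htop', Subgroup.relIndex_top_right, Subgroup.relIndex_subgroupOf hNA] at h1
    rw [Subgroup.relIndex, h1]
    exact hSN
  · have hNA' : IsPiNumber sᶜ (N.relIndex A) :=
      (hN.of_dvd ⟨_, (Subgroup.relIndex_mul_relIndex N A B hNA hAB).symm⟩).compl_of_ne hσ hs ht hst
    refine (hSN.mul hNA').of_dvd ?_
    rw [← Subgroup.inf_relIndex_right S N, Subgroup.relIndex_mul_relIndex _ _ _ inf_le_right hNA]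
    exact Subgroup.relIndex_dvd_of_le_left A inf_le_left

/-- A Hall `s`-subgroup of `G`, `s ∈ σ`, meets a `σ`-subnormal subgroup in a Hall subgroup. -/
theorem IsHall.subgroupOf [Finite G] (hσ : Setoid.IsPartition σ) {s : Set Nat.Primes}
    (hs : s ∈ σ) {S A : Subgroup G} (hS : IsHall s S) (h : IsSigmaSubnormal σ A) :
    IsHall s (S.subgroupOf A) := by
  refine ⟨?_, ?_⟩
  · exact hS.1.of_dvd (Subgroup.card_comap_dvd_of_injective S A.subtype A.subtype_injective)
  · change IsPiNumber sᶜ (S.relIndex A)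
    induction h using Relation.ReflTransGen.head_induction_on with
    | refl => simpa using hS.2
    | head h _ ih => exact h.isPiNumber_compl_relIndex hσ hs ih

theorem le_of_isHall_of_isSigmaSubnormal [Finite G] (hσ : Setoid.IsPartition σ)
    {s : Set Nat.Primes} (hs : s ∈ σ) {S A : Subgroup G} (hS : IsHall s S)
    (h : IsSigmaSubnormal σ A) (hA : IsPiNumber s (Nat.card A)) : A ≤ S := by
  rw [← Subgroup.relIndex_eq_one]
  exact Nat.eq_one_of_dvd_coprimes (hA.coprime (hS.subgroupOf hσ hs h).2)
    (Subgroup.relIndex_dvd_card S A) dvd_rfl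

/-! ### Elements of prime power order -/

theorem mem_of_pow_eq_one_of_le_normalizer [Finite G] {N Y : Subgroup G}
    (hY : Y ≤ Subgroup.normalizer (N : Set G)) {q a : ℕ} (hq : q.Prime)
    (hqN : ¬ q ∣ N.relIndex Y) {y : G} (hy : y ∈ Y) (hya : y ^ q ^ a = 1) : y ∈ N := by
  have : (N.subgroupOf Y).Normal := Subgroup.normal_subgroupOf_of_le_normalizer hY
  have h1 : y ^ N.relIndex Y ∈ N := (N.subgroupOf Y).pow_index_mem ⟨y, hy⟩
  have h2 : (N.relIndex Y).Coprime (orderOf y) :=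
    (((hq.coprime_iff_not_dvd.2 hqN).pow_left a).coprime_dvd_left
      (orderOf_dvd_of_pow_eq_one hya)).symm
  obtain ⟨m, hm⟩ := exists_pow_eq_self_of_coprime h2
  rw [← hm]
  exact pow_mem h1 m

/-- If `C` is `σ`-subnormal in `Y` and its index in `Y` is an `s`-number, then `C` contains the
`q`-elements of `Y` for the primes `q ∉ s`. -/
theorem SigmaSubnormalIn.mem_of_pow_eq_one [Finite G] (hσ : Setoid.IsPartition σ)
    {s : Set Nat.Primes} (hs : s ∈ σ) {C Y : Subgroup G} (h : SigmaSubnormalIn σ C Y)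
    (hC : IsPiNumber s (C.relIndex Y)) {q : Nat.Primes} (hq : q ∉ s) {y : G} (hy : y ∈ Y) {a : ℕ}
    (hya : y ^ (q : ℕ) ^ a = 1) : y ∈ C := by
  induction h using Relation.ReflTransGen.head_induction_on with
  | refl => exact hy
  | @head A B hAB hBY ih =>
    rw [sigmaSubnormalStep_iff] at hAB
    have hmul := Subgroup.relIndex_mul_relIndex A B Y hAB.1 (SigmaSubnormalIn.le hBY)
    have hAB' := hC.of_dvd ⟨_, hmul.symm⟩
    have hyB := ih (hC.of_dvd ⟨_, (mul_comm _ _).trans hmul |>.symm⟩)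
    rcases hAB.2 with h | ⟨t, ht, N, hNA, hN, hNt⟩
    · exact mem_of_pow_eq_one_of_le_normalizer h q.2 (fun hd => hq (hAB' q hd)) hyB hya
    · by_cases hqt : q ∈ t
      · have hst : s ≠ t := fun h => hq (h ▸ hqt)
        have h1 := (hNt.compl_of_ne hσ hs ht hst).of_dvd (Subgroup.relIndex_dvd_of_le_left B hNA)
        exact Subgroup.relIndex_eq_one.1
          (Nat.eq_one_of_dvd_coprimes (hAB'.coprime h1) dvd_rfl dvd_rfl) hyB
      · exact hNA (mem_of_pow_eq_one_of_le_normalizer hN q.2 (fun hd => hqt (hNt q hd)) hyB hya)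

/-- A subgroup that contains all `q`-elements contains a Sylow `q`-subgroup. -/
theorem not_dvd_index_of_pow_eq_one_mem [Finite G] {M : Subgroup G} {q : ℕ} (hq : q.Prime)
    (h : ∀ (y : G) (a : ℕ), y ^ q ^ a = 1 → y ∈ M) : ¬ q ∣ M.index := by
  have : Fact q.Prime := ⟨hq⟩
  let P : Sylow q G := default
  have hP : (P : Subgroup G) ≤ M := fun y hy => by
    obtain ⟨a, ha⟩ := P.isPGroup' ⟨y, hy⟩
    exact h y a (congrArg Subtype.val ha)
  exact fun hd => P.not_dvd_index (hd.trans (Subgroup.index_dvd_of_le hP))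

theorem not_dvd_relIndex_of_pow_eq_one_mem [Finite G] {M Y : Subgroup G} {q : ℕ} (hq : q.Prime)
    (h : ∀ y ∈ Y, ∀ a : ℕ, y ^ q ^ a = 1 → y ∈ M) : ¬ q ∣ M.relIndex Y :=
  not_dvd_index_of_pow_eq_one_mem hq fun y a hya =>
    h y y.2 a (by simpa using congrArg Subtype.val hya)

/-! ### Joins of `σ`-subnormal subgroups -/

/-- In a `σ`-soluble group with Hall `s`-subgroups for all `s ∈ σ`, the join `A ⊔ B` of
two `σ`-subnormal subgroups is `σ`-subnormal.

By induction one may assume that `G = (A ⊔ B) R` for a minimal normal subgroup `R`, an `s`-group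
for some `s ∈ σ`. As `R` normalizes the subgroup generated by the `q`-elements of `A`, `q ∉ s`,
the normal closure `D` of these elements of `A` and `B` lies in `A ⊔ B`. The images of `A` and `B`
in `G ⧸ D` are `σ`-subnormal `s`-groups, so they lie in a common Hall `s`-subgroup, and `G ⧸ D` is
an `s`-group. -/
theorem IsSigmaSubnormal.sup (hσ : Setoid.IsPartition σ) {G : Type u} [Group G]
    [Finite G] (hG : HasPrimarySeries σ G) (hHall : ∀ s ∈ σ, ∃ S : Subgroup G, IsHall s S)
    {A B : Subgroup G} (hA : IsSigmaSubnormal σ A) (hB : IsSigmaSubnormal σ B) :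
    IsSigmaSubnormal σ (A ⊔ B) := by
  induction hk : Nat.card G using Nat.strong_induction_on generalizing G with
  | _ k ih =>
  by_cases hnt : Nontrivial G
  swap
  · rw [not_nontrivial_iff_subsingleton] at hnt
    rw [Subsingleton.elim (A ⊔ B) ⊤]
    exact .refl
  obtain ⟨R, hR⟩ := exists_isChiefFactor_bot (G := G)
  have hRn := hR.2.1
  obtain ⟨s, hs, hRs⟩ := hG.isPrimaryNumber_card hR
  have hsurj := QuotientGroup.mk'_surjective R
  have hquot : IsSigmaSubnormal σ (A ⊔ B ⊔ R) := by
    have hlt : Nat.card (G ⧸ R) < k := hk ▸ hR.card_quotient_lt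
    have := ih _ hlt (hG.of_surjective _ hsurj)
      (fun t ht => let ⟨S, hS⟩ := hHall t ht; ⟨_, hS.map hsurj⟩) (hA.map hsurj) (hB.map hsurj) rfl
    have h1 := this.comap (QuotientGroup.mk' R)
    rwa [← Subgroup.map_sup, Subgroup.comap_map_eq, QuotientGroup.ker_mk'] at h1
  by_cases htop : A ⊔ B ⊔ R = ⊤
  swap
  · set Y := A ⊔ B ⊔ R with hY
    have hlt : Nat.card Y < k := by
      rw [← hk]
      exact (Subgroup.card_le_card_group Y).lt_of_ne fun h => htop (Subgroup.eq_top_of_card_eq Y h)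
    have := ih _ hlt (hG.of_injective _ Y.subtype_injective)
      (fun t ht => let ⟨S, hS⟩ := hHall t ht; ⟨_, hS.subgroupOf hσ ht hquot⟩)
      (isSigmaSubnormal_subgroupOf hA Y) (isSigmaSubnormal_subgroupOf hB Y) rfl
    rw [← Subgroup.subgroupOf_sup (le_sup_left.trans le_sup_left)
      (le_sup_right.trans le_sup_left)] at this
    exact (sigmaSubnormalIn_of_subgroupOf le_sup_left this).trans hquot
  let T : Set G := {y | (y ∈ A ∨ y ∈ B) ∧ ∃ q : Nat.Primes, q ∉ s ∧ ∃ a, y ^ (q : ℕ) ^ a = 1}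
  let D := Subgroup.normalClosure T
  have hconj : ∀ C : Subgroup G, IsSigmaSubnormal σ C → ∀ y ∈ C, ∀ q : Nat.Primes, q ∉ s →
      ∀ a, y ^ (q : ℕ) ^ a = 1 → ∀ r ∈ R, r * y * r⁻¹ ∈ C := by
    intro C hC y hy q hq a hya r hr
    have h1 := sigmaSubnormalIn_of_subgroupOf (le_sup_left : C ≤ C ⊔ R)
      (isSigmaSubnormal_subgroupOf hC _)
    refine h1.mem_of_pow_eq_one hσ hs ?_ hq (a := a) ?_ ?_
    · rw [relIndex_sup_eq_of_normal]
      exact hRs.of_dvd (Subgroup.relIndex_dvd_card C R)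
    · have hr' : r ∈ C ⊔ R := Subgroup.mem_sup_right hr
      exact mul_mem (mul_mem hr' (Subgroup.mem_sup_left hy)) (inv_mem hr')
    · rw [conj_pow, hya, mul_one, mul_inv_cancel]
  have hD : D ≤ A ⊔ B := by
    refine (Subgroup.closure_le _).2 fun x hx => ?_
    obtain ⟨y, ⟨hy, q, hq, a, hya⟩, hyx⟩ := Group.mem_conjugatesOfSet_iff.1 hx
    obtain ⟨g, rfl⟩ := isConj_iff.1 hyx
    have hg : g ∈ A ⊔ B ⊔ R := htop ▸ Subgroup.mem_top g
    obtain ⟨h, hh, r, hr, rfl⟩ := Subgroup.mem_sup_of_normal_right.1 hg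
    have h1 : r * y * r⁻¹ ∈ A ⊔ B := by
      rcases hy with hy | hy
      · exact Subgroup.mem_sup_left (hconj A hA y hy q hq a hya r hr)
      · exact Subgroup.mem_sup_right (hconj B hB y hy q hq a hya r hr)
    have h2 : h * r * y * (h * r)⁻¹ = h * (r * y * r⁻¹) * h⁻¹ := by group
    rw [h2]
    exact mul_mem (mul_mem hh h1) (inv_mem hh)
  have hDsurj := QuotientGroup.mk'_surjective D
  obtain ⟨S, hS⟩ := hHall s hs
  have himage : ∀ C : Subgroup G, IsSigmaSubnormal σ C → (∀ y ∈ C, y ∈ A ∨ y ∈ B) →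
      C.map (QuotientGroup.mk' D) ≤ S.map (QuotientGroup.mk' D) := by
    intro C hC hCAB
    refine le_of_isHall_of_isSigmaSubnormal hσ hs (hS.map hDsurj) (hC.map hDsurj) ?_
    rw [← Subgroup.relIndex_ker, QuotientGroup.ker_mk']
    intro q hq
    by_contra hqs
    exact not_dvd_relIndex_of_pow_eq_one_mem q.2 (fun y hy a hya =>
      Subgroup.subset_normalClosure (show y ∈ T from ⟨hCAB y hy, q, hqs, a, hya⟩)) hq
  have hsup : (A ⊔ B).map (QuotientGroup.mk' D) ≤ S.map (QuotientGroup.mk' D) := by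
    rw [Subgroup.map_sup]
    exact sup_le (himage A hA fun y => .inl) (himage B hB fun y => .inr)
  refine .single (sigmaSubnormalStep_iff.2 ⟨le_top, .inr ⟨s, hs, D, hD,
    Subgroup.le_normalizer_of_normal, ?_⟩⟩)
  rw [← Subgroup.relIndex_mul_relIndex D (A ⊔ B) ⊤ hD le_top]
  refine .mul ?_ ?_
  · have := (hS.map hDsurj).1.of_dvd (Subgroup.card_dvd_of_le hsup)
    rwa [← Subgroup.relIndex_ker, QuotientGroup.ker_mk'] at this
  · rw [← htop, relIndex_sup_eq_of_normal]
    exact hRs.of_dvd (Subgroup.relIndex_dvd_card _ R)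

/-! ### Prime divisors of the order -/

/-- An abelian minimal normal subgroup is elementary abelian: the elements of order dividing `p`
form a normal subgroup. -/
theorem IsChiefFactor.pow_eq_one [Finite G] {R : Subgroup G} (h : IsChiefFactor ⊥ R)
    [IsMulCommutative R] {p : ℕ} (hp : p.Prime) (hpR : p ∣ Nat.card R) :
    ∀ x ∈ R, x ^ p = 1 := by
  have hcomm : ∀ x ∈ R, ∀ y ∈ R, x * y = y * x := fun x hx y hy =>
    congrArg Subtype.val (mul_comm' (⟨x, hx⟩ : R) ⟨y, hy⟩)
  let E : Subgroup G :=
    { carrier := {x | x ∈ R ∧ x ^ p = 1}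
      mul_mem' := fun {x y} hx hy => ⟨mul_mem hx.1 hy.1, by
        rw [Commute.mul_pow (hcomm x hx.1 y hy.1), hx.2, hy.2, one_mul]⟩
      one_mem' := ⟨one_mem R, one_pow p⟩
      inv_mem' := fun {x} hx => ⟨inv_mem hx.1, by rw [inv_pow, hx.2, inv_one]⟩ }
  have hE : E.Normal := ⟨fun x hx g => ⟨h.2.1.conj_mem x hx.1 g, by
    rw [conj_pow, hx.2, mul_one, mul_inv_cancel]⟩⟩
  rcases h.eq_bot_or_eq hE fun x hx => hx.1 with hE' | hE'
  · have : Fact p.Prime := ⟨hp⟩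
    obtain ⟨x, hx⟩ := exists_prime_orderOf_dvd_card' p hpR
    have hxE : (x : G) ∈ E := ⟨x.2, by
      rw [← hx]
      exact_mod_cast congrArg Subtype.val (pow_orderOf_eq_one x)⟩
    rw [hE', Subgroup.mem_bot] at hxE
    rw [show x = 1 from Subtype.ext hxE, orderOf_one] at hx
    exact absurd hx hp.one_lt.ne
  · intro x hx
    rw [← hE'] at hx
    exact hx.2

theorem IsChiefFactor.exists_card_eq_prime_pow [Finite G] [Group.IsSolvable G] {R : Subgroup G}
    (h : IsChiefFactor ⊥ R) : ∃ p : ℕ, p.Prime ∧ ∃ k, Nat.card R = p ^ k := by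
  have := h.isMulCommutative inferInstance
  obtain ⟨p, hp, hpR⟩ := Nat.exists_prime_and_dvd (Subgroup.card_eq_one.not.2 h.2.2.1.ne')
  have : Fact p.Prime := ⟨hp⟩
  refine ⟨p, hp, IsPGroup.iff_card.1 fun x => ⟨1, ?_⟩⟩
  rw [pow_one]
  exact Subtype.ext (h.pow_eq_one hp hpR x x.2)

/-- A maximal subgroup of a finite soluble group has prime power index. -/
theorem exists_index_eq_prime_pow_of_isCoatom (G : Type u) [Group G] [Finite G]
    [hG : Group.IsSolvable G] {M : Subgroup G} (hM : IsCoatom M) :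
    ∃ p : ℕ, p.Prime ∧ ∃ k, M.index = p ^ k := by
  induction hk : Nat.card G using Nat.strong_induction_on generalizing G with
  | _ k ih =>
  have hnt : Nontrivial G := by
    by_contra hcon
    rw [not_nontrivial_iff_subsingleton] at hcon
    exact hM.1 (Subsingleton.elim _ _)
  obtain ⟨R, hR⟩ := exists_isChiefFactor_bot (G := G)
  have hRn := hR.2.1
  have hsurj := QuotientGroup.mk'_surjective R
  by_cases hRM : R ≤ M
  · have hlt : Nat.card (G ⧸ R) < k := hk ▸ hR.card_quotient_lt
    have hker : (QuotientGroup.mk' R).ker ≤ M := by rwa [QuotientGroup.ker_mk']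
    have hcm : (M.map (QuotientGroup.mk' R)).comap (QuotientGroup.mk' R) = M :=
      Subgroup.comap_map_eq_self hker
    have hcoatom : IsCoatom (M.map (QuotientGroup.mk' R)) := by
      refine ⟨fun h => hM.1 ?_, fun N hN => ?_⟩
      · rw [← hcm, h, Subgroup.comap_top]
      · rw [← Subgroup.comap_lt_comap_of_surjective hsurj, hcm] at hN
        exact Subgroup.comap_injective hsurj (by rw [hM.2 _ hN, Subgroup.comap_top])
    obtain ⟨p, hp, j, hj⟩ := ih _ hlt (G ⧸ R) hcoatom rfl
    rw [Subgroup.index_map_eq M hsurj hker] at hj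
    exact ⟨p, hp, j, hj⟩
  · obtain ⟨p, hp, j, hj⟩ := hR.exists_card_eq_prime_pow
    have hMR : M ⊔ R = ⊤ := hM.2 _ (lt_of_le_of_ne le_sup_left fun h => hRM (h ▸ le_sup_right))
    have hd : M.index ∣ p ^ j := by
      rw [← hj, ← Subgroup.relIndex_top_right, ← hMR, relIndex_sup_eq_of_normal]
      exact Subgroup.relIndex_dvd_card M R
    obtain ⟨i, -, hi⟩ := (Nat.dvd_prime_pow hp).1 hd
    exact ⟨p, hp, i, hi⟩

theorem isCoatom_subgroupOf {A B : Subgroup G} (h : A ⋖ B) : IsCoatom (A.subgroupOf B) := by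
  refine ⟨fun h1 => h.lt.not_ge (Subgroup.subgroupOf_eq_top.1 h1), fun N hN => ?_⟩
  have hlt : A < N.map B.subtype := by
    rw [← inf_eq_left.2 h.le, ← Subgroup.subgroupOf_map_subtype]
    exact (Subgroup.map_lt_map_iff_of_injective B.subtype_injective).2 hN
  rcases h.eq_or_eq hlt.le (Subgroup.map_subtype_le N) with h1 | h1
  · exact absurd h1 hlt.ne'
  · refine Subgroup.map_injective B.subtype_injective ?_
    rw [h1, ← MonoidHom.range_eq_map, Subgroup.range_subtype]

/-- In a finite soluble group each step of a maximal chain contributes one prime to the index. -/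
theorem IsNMaximal.card_primeFactors_index_le [Finite G] [Group.IsSolvable G] {n : ℕ}
    {H : Subgroup G} (h : IsNMaximal n H) : H.index.primeFactors.card ≤ n := by
  induction n generalizing H with
  | zero =>
    obtain rfl : H = ⊤ := h
    simp
  | succ n ih =>
    obtain ⟨M, hM, hHM⟩ := h
    obtain ⟨p, hp, k, hk⟩ := exists_index_eq_prime_pow_of_isCoatom M (isCoatom_subgroupOf hHM)
    rw [← Subgroup.relIndex_mul_index hHM.le, Subgroup.relIndex, Nat.primeFactors_mul
      Subgroup.index_ne_zero_of_finite Subgroup.index_ne_zero_of_finite]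
    refine (Finset.card_union_le _ _).trans ?_
    rw [add_comm n]
    refine Nat.add_le_add ?_ (ih hM)
    rw [hk]
    rcases eq_or_ne k 0 with rfl | hk0
    · simp
    · rw [Nat.primeFactors_prime_pow hk0 hp, Finset.card_singleton]

/-- A finite group with at most one maximal subgroup has prime power order: otherwise its Sylow
subgroups are proper, so that the maximal subgroup contains them all. -/
theorem card_primeFactors_le_one_of_isCoatom_unique [Finite G]
    (h : ∀ A B : Subgroup G, IsCoatom A → IsCoatom B → A = B) :
    (Nat.card G).primeFactors.card ≤ 1 := by
  refine Finset.card_le_one.2 fun p hp q hq => ?_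
  by_contra hpq
  rw [Nat.mem_primeFactors] at hp hq
  have hne : ∀ l : ℕ, l.Prime → ∀ P : Sylow l G, (P : Subgroup G) ≠ ⊤ := by
    intro l hl P hP
    have : Fact l.Prime := ⟨hl⟩
    obtain ⟨k, hk⟩ := IsPGroup.iff_card.1 P.isPGroup'
    rw [hP, Subgroup.card_top] at hk
    have h1 := (Nat.prime_dvd_prime_iff_eq hp.1 hl).1 (hp.1.dvd_of_dvd_pow (hk ▸ hp.2.1))
    have h2 := (Nat.prime_dvd_prime_iff_eq hq.1 hl).1 (hq.1.dvd_of_dvd_pow (hk ▸ hq.2.1))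
    exact hpq (h1.trans h2.symm)
  obtain ⟨M, hM, -⟩ := (eq_top_or_exists_le_coatom
    ((default : Sylow p G) : Subgroup G)).resolve_left (hne p hp.1 _)
  obtain ⟨l, hl, hlM⟩ := Nat.exists_prime_and_dvd (Subgroup.index_eq_one.not.2 hM.1)
  have : Fact l.Prime := ⟨hl⟩
  let P : Sylow l G := default
  obtain ⟨M', hM', hPM'⟩ := (eq_top_or_exists_le_coatom (P : Subgroup G)).resolve_left (hne l hl P)
  rw [← h M M' hM hM'] at hPM'
  exact P.not_dvd_index (hlM.trans (Subgroup.index_dvd_of_le hPM'))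

/-- If all maximal subgroups of `H`, but not `H`, are `σ`-subnormal in `G`, then `H` has only one
maximal subgroup, by `IsSigmaSubnormal.sup`, and hence prime power order. -/
theorem card_primeFactors_le_of_isSigmaSubnormal [Finite G] [Group.IsSolvable G]
    (hσ : Setoid.IsPartition σ) (hG : HasPrimarySeries σ G)
    (hHall : ∀ s ∈ σ, ∃ S : Subgroup G, IsHall s S) {n : ℕ}
    (h : ∀ H : Subgroup G, IsNMaximal (n + 1) H → IsSigmaSubnormal σ H)
    {H : Subgroup G} (hH : IsNMaximal n H) (hns : ¬ IsSigmaSubnormal σ H) :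
    (Nat.card G).primeFactors.card ≤ n + 1 := by
  have h1 : (Nat.card H).primeFactors.card ≤ 1 := by
    refine card_primeFactors_le_one_of_isCoatom_unique fun A B hA hB => ?_
    have hmap : ∀ A : Subgroup H, IsCoatom A → IsSigmaSubnormal σ (A.map H.subtype) :=
      fun A hA => h _ (hH.map_subtype (.of_isCoatom hA))
    by_contra hAB
    refine hns ?_
    have := IsSigmaSubnormal.sup hσ hG hHall (hmap A hA) (hmap B hB)
    rwa [← Subgroup.map_sup, hA.sup_eq_top_of_ne hB hAB, ← MonoidHom.range_eq_map,
      Subgroup.range_subtype] at this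
  rw [← Subgroup.card_mul_index H, Nat.primeFactors_mul Nat.card_pos.ne'
    Subgroup.index_ne_zero_of_finite]
  have h2 := Finset.card_union_le (Nat.card H).primeFactors H.index.primeFactors
  have h3 := hH.card_primeFactors_index_le
  omega

/-! ### Subgroups permuting with Hall subgroups -/

/-- `V` permutes with all conjugates of some Hall `s`-subgroup, for each `s ∈ σ`. This is
implied by `σ`-quasinormality; as the Hall subgroups need not belong to a given set of subgroups,
it passes easily to quotient groups. -/
def PermutesWithHall (σ : Set (Set Nat.Primes)) (V : Subgroup G) : Prop :=
  ∀ s ∈ σ, ∃ E : Subgroup G, IsHall s E ∧ ∀ x : G,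
    (V : Set G) * ((MulAut.conj x • E : Subgroup G) : Set G) =
      ((MulAut.conj x • E : Subgroup G) : Set G) * (V : Set G)

theorem isHall_bot_of_notMem_sigmaOf {s : Set Nat.Primes} (hs : s ∈ σ)
    (h : s ∉ sigmaOf σ (Nat.card G)) : IsHall s (⊥ : Subgroup G) := by
  refine ⟨by simpa using isPiNumber_one s, fun p hp hps => h ⟨hs, p, hps, ?_⟩⟩
  simpa using hp

theorem IsCompleteHallSet.exists_isHall {𝓗 : Set (Subgroup G)} (h : IsCompleteHallSet σ 𝓗)
    {s : Set Nat.Primes} (hs : s ∈ σ) : ∃ S : Subgroup G, IsHall s S := by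
  by_cases hsG : s ∈ sigmaOf σ (Nat.card G)
  · obtain ⟨S, hS, -⟩ := h.2 s hsG
    exact ⟨S, hS.2⟩
  · exact ⟨⊥, isHall_bot_of_notMem_sigmaOf hs hsG⟩

theorem IsSigmaQuasinormal.permutesWithHall {V : Subgroup G} (h : IsSigmaQuasinormal σ V) :
    PermutesWithHall σ V := by
  obtain ⟨𝓗, h𝓗, hV⟩ := h
  intro s hs
  by_cases hsG : s ∈ sigmaOf σ (Nat.card G)
  · obtain ⟨S, hS, -⟩ := h𝓗.2 s hsG
    exact ⟨S, hS.2, hV S hS.1⟩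
  · refine ⟨⊥, isHall_bot_of_notMem_sigmaOf hs hsG, fun x => ?_⟩
    rw [Subgroup.smul_bot, Subgroup.coe_bot, Set.singleton_one, mul_one, one_mul]

theorem PermutesWithHall.map [Finite G] {f : G →* G'} (hf : Function.Surjective f)
    {V : Subgroup G} (h : PermutesWithHall σ V) : PermutesWithHall σ (V.map f) := by
  intro s hs
  obtain ⟨E, hE, hV⟩ := h s hs
  refine ⟨E.map f, hE.map hf, fun y => ?_⟩
  obtain ⟨x, rfl⟩ := hf y
  have h1 : (MulAut.conj (f x) • E.map f : Subgroup G') = (MulAut.conj x • E).map f := by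
    ext z
    simp only [Subgroup.mem_map, Subgroup.mem_smul_pointwise_iff_exists, MulAut.smul_def,
      MulAut.conj_apply]
    constructor
    · rintro ⟨_, ⟨e, he, rfl⟩, rfl⟩
      exact ⟨_, ⟨e, he, rfl⟩, by simp⟩
    · rintro ⟨_, ⟨e, he, rfl⟩, rfl⟩
      exact ⟨_, ⟨e, he, rfl⟩, by simp⟩
  rw [h1, Subgroup.coe_map, Subgroup.coe_map, ← Set.image_mul, hV, Set.image_mul]

/-- By Sylow's theorem each `q`-element lies in a conjugate of a given Hall `s`-subgroup, `q ∈ s`. -/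
theorem IsHall.exists_mem_conj [Finite G] {s : Set Nat.Primes} {E : Subgroup G}
    (hE : IsHall s E) {q : Nat.Primes} (hq : q ∈ s) {y : G} {a : ℕ}
    (hy : y ^ (q : ℕ) ^ a = 1) : ∃ x : G, y ∈ (MulAut.conj x • E : Subgroup G) := by
  have : Fact (q : ℕ).Prime := ⟨q.2⟩
  let P : Sylow q E := default
  have hP : IsPGroup q ((P : Subgroup E).map E.subtype) := P.isPGroup'.map _
  have hidx : ¬ (q : ℕ) ∣ ((P : Subgroup E).map E.subtype).index := by
    rw [Subgroup.index_map_subtype, q.2.dvd_mul, not_or]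
    exact ⟨P.not_dvd_index, fun h => hE.2 q h hq⟩
  have hyp : IsPGroup q (Subgroup.zpowers y) := by
    obtain ⟨j, -, hj⟩ := (Nat.dvd_prime_pow q.2).1 (orderOf_dvd_of_pow_eq_one hy)
    exact IsPGroup.of_card (n := j) (by rw [Nat.card_zpowers, hj])
  obtain ⟨Q, hQ⟩ := hyp.exists_le_sylow
  obtain ⟨x, hx⟩ := MulAction.exists_smul_eq G (hP.toSylow hidx) Q
  refine ⟨x, ?_⟩
  have h1 : y ∈ (Q : Subgroup G) := hQ (Subgroup.mem_zpowers y)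
  rw [← hx, Sylow.coe_subgroup_smul] at h1
  exact Subgroup.pointwise_smul_le_pointwise_smul_iff.2 (Subgroup.map_subtype_le _) h1

/-- `σ`-quasinormal subgroups are `σ`-subnormal. For a minimal normal `s`-subgroup `R`, the
`q`-elements of `V R` with `q ∉ s` lie in `V`, so `V` is `σ`-subnormal in `V R` in one step. -/
theorem PermutesWithHall.isSigmaSubnormal (hσ : Setoid.IsPartition σ) {G : Type u} [Group G]
    [Finite G] (hG : HasPrimarySeries σ G) {V : Subgroup G} (hV : PermutesWithHall σ V) :
    IsSigmaSubnormal σ V := by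
  induction hk : Nat.card G using Nat.strong_induction_on generalizing G with
  | _ k ih =>
  by_cases hnt : Nontrivial G
  swap
  · rw [not_nontrivial_iff_subsingleton] at hnt
    rw [Subsingleton.elim V ⊤]
    exact .refl
  obtain ⟨R, hR⟩ := exists_isChiefFactor_bot (G := G)
  have hRn := hR.2.1
  obtain ⟨s, hs, hRs⟩ := hG.isPrimaryNumber_card hR
  have hsurj := QuotientGroup.mk'_surjective R
  have hquot : IsSigmaSubnormal σ (V ⊔ R) := by
    have hlt : Nat.card (G ⧸ R) < k := hk ▸ hR.card_quotient_lt
    have h1 := (ih _ hlt (hG.of_surjective _ hsurj) (hV.map hsurj) rfl).comap (QuotientGroup.mk' R)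
    rwa [Subgroup.comap_map_eq, QuotientGroup.ker_mk'] at h1
  set Y := V ⊔ R with hY
  have hVY : IsPiNumber s (V.relIndex Y) := by
    rw [relIndex_sup_eq_of_normal]
    exact hRs.of_dvd (Subgroup.relIndex_dvd_card V R)
  have key : ∀ q : Nat.Primes, q ∉ s → ∀ y ∈ Y, ∀ a, y ^ (q : ℕ) ^ a = 1 → y ∈ V := by
    intro q hq y hy a hya
    obtain ⟨t, ht, hqt⟩ := (hσ.2 q).exists
    obtain ⟨E₀, hE₀, hperm⟩ := hV t ht
    obtain ⟨x, hx⟩ := hE₀.exists_mem_conj hqt hya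
    set E := MulAut.conj x • E₀ with hE
    have hEt : IsPiNumber t (Nat.card E) := by
      rw [hE, Nat.card_congr (Subgroup.equivSMul (MulAut.conj x) E₀).symm.toEquiv]
      exact hE₀.1
    have hperm' : (V : Set G) * (E ⊓ Y : Subgroup G) = (E ⊓ Y : Subgroup G) * V := by
      have hVleY : V ≤ Y := le_sup_left
      refine subset_antisymm ?_ ?_
      · rintro _ ⟨v, hv, e, ⟨he, heY⟩, rfl⟩
        obtain ⟨e', he', v', hv', h⟩ := (hperm x).subset (Set.mul_mem_mul hv he)
        refine ⟨e', ⟨he', ?_⟩, v', hv', h⟩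
        have h' : e' * v' = v * e := h
        exact (Y.mul_mem_cancel_right (hVleY hv')).1 (h' ▸ mul_mem (hVleY hv) heY)
      · rintro _ ⟨e, ⟨he, heY⟩, v, hv, rfl⟩
        obtain ⟨v', hv', e', he', h⟩ := (hperm x).superset (Set.mul_mem_mul he hv)
        refine ⟨v', hv', e', ⟨he', ?_⟩, h⟩
        have h' : v' * e' = e * v := h
        exact (Y.mul_mem_cancel_left (hVleY hv')).1 (h' ▸ mul_mem heY (hVleY hv))
    have hst : s ≠ t := fun h => hq (h ▸ hqt)
    have h1 : IsPiNumber t (V.relIndex (E ⊓ Y)) :=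
      hEt.of_dvd ((Subgroup.relIndex_dvd_card V _).trans (Subgroup.card_dvd_of_le inf_le_left))
    have h2 : V.relIndex (E ⊓ Y) ∣ V.relIndex Y := by
      rw [← relIndex_sup_of_mul_comm hperm']
      exact ⟨_, (Subgroup.relIndex_mul_relIndex _ _ _ le_sup_left
        (sup_le le_sup_left inf_le_right)).symm⟩
    exact Subgroup.relIndex_eq_one.1 (Nat.eq_one_of_dvd_coprimes
      ((hVY.of_dvd h2).coprime (h1.compl_of_ne hσ hs ht hst)) dvd_rfl dvd_rfl) ⟨hx, hy⟩
  refine Relation.ReflTransGen.head ⟨le_sup_left, .inr ⟨s, hs, ?_⟩⟩ hquot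
  rw [← Subgroup.index_eq_card]
  intro q hqd
  by_contra hq
  refine not_dvd_index_of_pow_eq_one_mem q.2 (fun y a hya b => ?_) hqd
  refine key q hq _ (b * y * b⁻¹).2 a ?_
  have h1 : (b * y * b⁻¹) ^ (q : ℕ) ^ a = 1 := by rw [conj_pow, hya, mul_one, mul_inv_cancel]
  exact congrArg Subtype.val h1

/-- A subgroup that permutes with Hall subgroups meets a normal `s`-subgroup `R` in a subgroup
normalized by all `q`-elements, `q ∉ s`. -/
theorem PermutesWithHall.conj_mem_inf [Finite G] (hσ : Setoid.IsPartition σ) {V R : Subgroup G}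
    (hV : PermutesWithHall σ V) [hRn : R.Normal] {s : Set Nat.Primes} (hs : s ∈ σ)
    (hR : IsPiNumber s (Nat.card R)) {q : Nat.Primes} (hq : q ∉ s) {y : G} {a : ℕ}
    (hya : y ^ (q : ℕ) ^ a = 1) {r : G} (hr : r ∈ V ⊓ R) : y * r * y⁻¹ ∈ V ⊓ R := by
  obtain ⟨t, ht, hqt⟩ := (hσ.2 q).exists
  obtain ⟨E₀, hE₀, hperm⟩ := hV t ht
  obtain ⟨x, hx⟩ := hE₀.exists_mem_conj hqt hya
  set E := MulAut.conj x • E₀ with hE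
  have hEt : IsPiNumber t (Nat.card E) := by
    rw [hE, Nat.card_congr (Subgroup.equivSMul (MulAut.conj x) E₀).symm.toEquiv]
    exact hE₀.1
  have hst : s ≠ t := fun h => hq (h ▸ hqt)
  set W := V ⊔ E with hW
  have h1 : V.relIndex (R ⊓ W) ∣ V.relIndex W := by
    have : ((R ⊓ W).subgroupOf W).Normal := by
      rw [Subgroup.inf_subgroupOf_right]
      infer_instance
    have := relIndex_dvd_index_of_normal_right (V.subgroupOf W) ((R ⊓ W).subgroupOf W)
    rwa [Subgroup.relIndex_subgroupOf inf_le_right] at this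
  have h2 : IsPiNumber t (V.relIndex W) := by
    rw [hW, relIndex_sup_of_mul_comm (hperm x)]
    exact hEt.of_dvd (Subgroup.relIndex_dvd_card V E)
  have h3 : IsPiNumber s (V.relIndex (R ⊓ W)) :=
    hR.of_dvd ((Subgroup.relIndex_dvd_card V _).trans (Subgroup.card_dvd_of_le inf_le_left))
  have h4 : R ⊓ W ≤ V := Subgroup.relIndex_eq_one.1 (Nat.eq_one_of_dvd_coprimes
    (h3.coprime ((h2.of_dvd h1).compl_of_ne hσ hs ht hst)) dvd_rfl dvd_rfl)
  have hyW : y ∈ W := Subgroup.mem_sup_right hx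
  have hyR : y * r * y⁻¹ ∈ R := hRn.conj_mem r hr.2 y
  have hyW' : y * r * y⁻¹ ∈ W :=
    mul_mem (mul_mem hyW (Subgroup.mem_sup_left hr.1)) (inv_mem hyW)
  exact ⟨h4 ⟨hyR, hyW'⟩, hyR⟩

/-! ### The rank -/

theorem exists_isNMaximal [Finite G] (H : Subgroup G) : ∃ d, IsNMaximal d H := by
  induction H using WellFoundedGT.induction with
  | ind H ih =>
    by_cases hH : H = ⊤
    · exact ⟨0, hH⟩
    · obtain ⟨M, hM, -⟩ := exists_covBy_le_of_lt (lt_top_iff_ne_top.2 hH)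
      obtain ⟨d, hd⟩ := ih M hM.lt
      exact ⟨d + 1, M, hd, hM⟩

theorem IsNMaximal.exists_le {d m : ℕ} {H : Subgroup G} (h : IsNMaximal d H) (hmd : m ≤ d) :
    ∃ M : Subgroup G, H ≤ M ∧ IsNMaximal m M := by
  induction d generalizing H with
  | zero =>
    obtain rfl : m = 0 := Nat.le_zero.1 hmd
    exact ⟨H, le_rfl, h⟩
  | succ d ih =>
    rcases hmd.eq_or_lt with rfl | hlt
    · exact ⟨H, le_rfl, h⟩
    · obtain ⟨M, hM, hHM⟩ := h
      obtain ⟨N, hMN, hN⟩ := ih hM (Nat.lt_succ_iff.1 hlt)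
      exact ⟨N, hHM.le.trans hMN, hN⟩

theorem covBy_of_card_eq_prime_mul [Finite G] {A B : Subgroup G} (hAB : A ≤ B) {q : ℕ}
    (hq : q.Prime) (h : Nat.card B = q * Nat.card A) : A ⋖ B := by
  have hidx : A.relIndex B = q := by
    refine Nat.eq_of_mul_eq_mul_left (Nat.card_pos (α := A)) ?_
    rw [mul_comm _ q, ← h, ← Subgroup.relIndex_bot_left A,
      Subgroup.relIndex_mul_relIndex _ _ _ bot_le hAB, Subgroup.relIndex_bot_left]
  refine ⟨lt_of_le_of_ne hAB fun hne => ?_, fun C hAC hCB => ?_⟩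
  · rw [hne, Subgroup.relIndex_self] at hidx
    exact hq.one_lt.ne hidx
  · rw [← Subgroup.relIndex_mul_relIndex A C B hAC.le hCB.le] at hidx
    rcases (Nat.prime_mul_iff.1 (hidx ▸ hq)) with h1 | h1
    · exact hCB.not_ge (Subgroup.relIndex_eq_one.1 h1.2)
    · exact hAC.not_ge (Subgroup.relIndex_eq_one.1 h1.2)

/-- In an elementary abelian group of order `p ^ k`, an element outside `⟨z⟩` can be separated
from `z` by a subgroup of any given order `p ^ m` with `1 ≤ m < k`. -/
theorem exists_subgroup_card_separating {A : Type u} [Group A] [Finite A]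
    (hc : ∀ a b : A, a * b = b * a) {p : ℕ} (hp : p.Prime) (hexp : ∀ a : A, a ^ p = 1) {k m : ℕ}
    (hk : Nat.card A = p ^ k) (hm : 1 ≤ m) (hmk : m < k) {z w : A}
    (hw : w ∉ Subgroup.zpowers z) : ∃ L : Subgroup A, Nat.card L = p ^ m ∧ z ∈ L ∧ w ∉ L := by
  have : Fact p.Prime := ⟨hp⟩
  -- A subgroup that is maximal subject to `z ∈ W` and `w ∉ W` has index `p`.
  obtain ⟨W, ⟨hzW, hwW⟩, hmax⟩ := exists_maximal_of_wellFoundedGT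
    (fun W : Subgroup A => Subgroup.zpowers z ≤ W ∧ w ∉ W) ⟨_, le_rfl, hw⟩
  have hnorm : ∀ N : Subgroup A, N.Normal := fun N =>
    ⟨fun n hn g => by rwa [hc g n, mul_inv_cancel_right]⟩
  have := hnorm W
  have hord : ∀ t : A, Nat.card (Subgroup.zpowers t) ∣ p := fun t => by
    rw [Nat.card_zpowers]
    exact orderOf_dvd_of_pow_eq_one (hexp t)
  have htop : W ⊔ Subgroup.zpowers w = ⊤ := by
    refine top_le_iff.1 fun t _ => ?_
    by_cases htW : t ∈ W
    · exact Subgroup.mem_sup_left htW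
    have h1 : w ∈ W ⊔ Subgroup.zpowers t := by
      by_contra hcon
      exact htW (hmax ⟨hzW.trans le_sup_left, hcon⟩ le_sup_left
        (Subgroup.mem_sup_right (Subgroup.mem_zpowers t)))
    have h2 : W ⊔ Subgroup.zpowers w ≤ W ⊔ Subgroup.zpowers t :=
      sup_le le_sup_left (Subgroup.zpowers_le.2 h1)
    have h3 : W.relIndex (W ⊔ Subgroup.zpowers t) = p := by
      rw [Subgroup.relIndex_sup_left]
      refine ((Nat.dvd_prime hp).1 ((Subgroup.relIndex_dvd_card _ _).trans (hord t))).resolve_left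
        fun h => htW ?_
      exact Subgroup.relIndex_eq_one.1 h (Subgroup.mem_zpowers t)
    have h4 : W.relIndex (W ⊔ Subgroup.zpowers w) ≠ 1 := fun h =>
      hwW (Subgroup.relIndex_eq_one.1 h (Subgroup.mem_sup_right (Subgroup.mem_zpowers w)))
    have h5 := Subgroup.relIndex_mul_relIndex _ _ _ (le_sup_left : W ≤ W ⊔ Subgroup.zpowers w) h2
    rw [h3] at h5
    rcases Nat.prime_mul_iff.1 (h5.symm ▸ hp) with h6 | h6
    · exact Subgroup.relIndex_eq_one.1 h6.2 (Subgroup.mem_sup_right (Subgroup.mem_zpowers t))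
    · exact absurd h6.2 h4
  have hWidx : W.index ∣ p := by
    rw [← Subgroup.relIndex_top_right, ← htop, Subgroup.relIndex_sup_left]
    exact (Subgroup.relIndex_dvd_card _ _).trans (hord w)
  have hWcard : p ^ m ∣ Nat.card W := by
    have h1 : p ^ k ∣ Nat.card W * p := by
      rw [← hk, ← Subgroup.card_mul_index W]
      exact mul_dvd_mul_left _ hWidx
    obtain ⟨j, rfl⟩ := Nat.exists_eq_add_of_lt hmk
    rw [pow_succ] at h1
    exact (pow_dvd_pow p (Nat.le_add_right m j)).trans (Nat.dvd_of_mul_dvd_mul_right hp.pos h1)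
  have hz1 : Nat.card (Subgroup.zpowers z) ∣ p ^ 1 := by
    rw [pow_one]
    exact hord z
  obtain ⟨i, hi1, hi⟩ := (Nat.dvd_prime_pow hp).1 hz1
  have hzc : Nat.card ((Subgroup.zpowers z).subgroupOf W) = p ^ i := by
    rw [← hi]
    exact Nat.card_congr (Subgroup.subgroupOfEquivOfLe hzW).toEquiv
  obtain ⟨K, hK, hzK⟩ := Sylow.exists_subgroup_card_pow_prime_le p hWcard
    ((Subgroup.zpowers z).subgroupOf W) hzc (hi1.trans hm)
  refine ⟨K.map W.subtype, ?_, ?_, fun h => hwW (Subgroup.map_subtype_le K h)⟩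
  · rw [← hK]
    exact Subgroup.card_map_of_injective W.subtype_injective
  · exact ⟨⟨z, hzW (Subgroup.mem_zpowers z)⟩, hzK (Subgroup.mem_zpowers z), rfl⟩

/-- In a `σ`-nilpotent group, `p`-elements and `q`-elements commute if `p` and `q` lie in different
members of `σ`. -/
theorem NilpotentStep.commute_of_pow_eq_one [Finite G] (hσ : Setoid.IsPartition σ)
    (h : NilpotentStep σ (⊥ : Subgroup G) ⊤) {s : Set Nat.Primes} (hs : s ∈ σ)
    {p q : Nat.Primes} (hp : p ∈ s) (hq : q ∉ s) {x y : G} {a b : ℕ}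
    (hx : x ^ (p : ℕ) ^ a = 1) (hy : y ^ (q : ℕ) ^ b = 1) : x * y = y * x := by
  obtain ⟨t, ht, hqt⟩ := (hσ.2 q).exists
  have hst : s ≠ t := fun h => hq (h ▸ hqt)
  obtain ⟨L, hL, -, -, hL1, hL2⟩ := h.2.2.2 s hs
  obtain ⟨M, hM, -, -, hM1, hM2⟩ := h.2.2.2 t ht
  have hxL : x ∈ L := mem_of_pow_eq_one_of_le_normalizer Subgroup.le_normalizer_of_normal p.2
    (fun hd => hL2 p hd hp) (Subgroup.mem_top x) hx
  have hyM : y ∈ M := mem_of_pow_eq_one_of_le_normalizer Subgroup.le_normalizer_of_normal q.2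
    (fun hd => hM2 q hd hqt) (Subgroup.mem_top y) hy
  rw [Subgroup.relIndex_bot_left] at hL1 hM1
  exact Subgroup.commute_of_normal_of_disjoint _ _ hL hM (Subgroup.disjoint_of_coprime_natCard
    (hL1.coprime (hM1.compl_of_ne hσ hs ht hst))) x y hxL hyM

/-- The dichotomy behind the bound for the rank. Let `R` be a minimal normal subgroup of order
`p ^ k`, `p ∈ s ∈ σ`, and suppose that some `q`-element, `q ∉ s`, does not centralize `R`; passing
to a power, let `x` be such an element with `x ^ q` centralizing `R`. Then `R⟨x⟩` is not
`σ`-nilpotent, hence not contained in an `(n - 1)`-maximal subgroup, so `R⟨x⟩` is `d`-maximal with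
`d + 2 ≤ n`. For `L ≤ R` of index `p ^ (n - d - 1)`, the subgroup `L⟨x ^ q⟩` is `n`-maximal and
meets `R` in `L`, so that `L` is normalized by all `q`-elements, `q ∉ s`. Unless `k < n`, this
applies to enough subgroups `L` to show that all subgroups of `R` are normalized. -/
theorem lt_or_conj_mem_zpowers [Finite G] [Group.IsSolvable G] (hσ : Setoid.IsPartition σ)
    (hG : HasPrimarySeries σ G) {n : ℕ} (hn : 0 < n)
    (h : ∀ H : Subgroup G, IsNMaximal n H → PermutesWithHall σ H)
    {R : Subgroup G} (hR : IsChiefFactor ⊥ R) {p : Nat.Primes} {k : ℕ}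
    (hk : Nat.card R = (p : ℕ) ^ k) {s : Set Nat.Primes} (hs : s ∈ σ) (hps : p ∈ s) :
    k < n ∨ ∀ q : Nat.Primes, q ∉ s → ∀ (y : G) (a : ℕ), y ^ (q : ℕ) ^ a = 1 →
      ∀ z ∈ R, y * z * y⁻¹ ∈ Subgroup.zpowers z := by
  have hpf : Fact (p : ℕ).Prime := ⟨p.2⟩
  have hRn := hR.2.1
  have := hR.isMulCommutative inferInstance
  have hRcomm : ∀ x y : R, x * y = y * x := fun x y => mul_comm' x y
  have hk0 : k ≠ 0 := by
    rintro rfl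
    exact hR.2.2.1.ne' (Subgroup.card_eq_one.1 (by simpa using hk))
  have hexp := hR.pow_eq_one p.2 (hk ▸ dvd_pow_self _ hk0)
  have hRs : IsPiNumber s (Nat.card R) := hk ▸ IsPiNumber.pow hps k
  by_cases hcent : ∀ q : Nat.Primes, q ∉ s → ∀ (y : G) (a : ℕ), y ^ (q : ℕ) ^ a = 1 →
      ∀ z ∈ R, y * z = z * y
  · refine .inr fun q hq y a hya z hz => ?_
    rw [hcent q hq y a hya z hz, mul_inv_cancel_right]
    exact Subgroup.mem_zpowers z
  obtain ⟨q, hq, x, a, hxa, hxR, hxqR⟩ : ∃ q : Nat.Primes, q ∉ s ∧ ∃ (x : G) (a : ℕ),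
      x ^ (q : ℕ) ^ a = 1 ∧ (¬ ∀ z ∈ R, x * z = z * x) ∧
        ∀ z ∈ R, x ^ (q : ℕ) * z = z * x ^ (q : ℕ) := by
    classical
    push Not at hcent
    obtain ⟨q, hq, y, a, hya, z, hz, hyz⟩ := hcent
    have hex : ∃ i, ∀ z ∈ R, y ^ (q : ℕ) ^ i * z = z * y ^ (q : ℕ) ^ i :=
      ⟨a, fun z _ => by rw [hya, one_mul, mul_one]⟩
    obtain ⟨i, hi⟩ : ∃ i, Nat.find hex = i + 1 := Nat.exists_eq_succ_of_ne_zero fun h0 =>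
      hyz (by simpa [h0] using Nat.find_spec hex z hz)
    refine ⟨q, hq, y ^ (q : ℕ) ^ i, a, ?_, Nat.find_min hex (by omega), ?_⟩
    · rw [← pow_mul, mul_comm, pow_mul, hya, one_pow]
    · rw [← pow_mul, ← pow_succ, ← hi]
      exact Nat.find_spec hex
  set X := R ⊔ Subgroup.zpowers x with hX
  obtain ⟨d, hd⟩ := exists_isNMaximal X
  have hdn : d + 2 ≤ n := by
    by_contra hcon
    obtain ⟨Y, hXY, hY⟩ := hd.exists_le (m := n - 1) (by omega)
    have hYnil := nilpotentChain_one.1 (nilpotentChain_of_isSigmaSubnormal hσ Y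
      (hG.of_injective _ Y.subtype_injective) zero_lt_one fun H hH => by
        have h1 := hY.map_subtype hH
        rw [Nat.sub_add_cancel hn] at h1
        have h2 := isSigmaSubnormal_subgroupOf ((h _ h1).isSigmaSubnormal hσ hG) Y
        rwa [Subgroup.subgroupOf, Subgroup.comap_map_eq_self_of_injective Y.subtype_injective]
          at h2)
    refine hxR fun z hz => ?_
    have hxY : x ∈ Y := hXY (Subgroup.mem_sup_right (Subgroup.mem_zpowers x))
    have hzY : z ∈ Y := hXY (Subgroup.mem_sup_left hz)
    have h1 := hYnil.commute_of_pow_eq_one hσ hs hps hq (x := ⟨z, hzY⟩) (y := ⟨x, hxY⟩) (a := 1)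
      (b := a) (Subtype.ext (by simpa using hexp z hz)) (Subtype.ext hxa)
    exact (congrArg Subtype.val h1).symm
  obtain ⟨j, rfl⟩ : ∃ j, n = d + 1 + j := ⟨n - (d + 1), by omega⟩
  by_cases hkj : k ≤ j
  · exact .inl (by omega)
  refine .inr ?_
  set Z := Subgroup.zpowers (x ^ (q : ℕ)) with hZ
  have hxq : orderOf x ∣ (q : ℕ) ^ a := orderOf_dvd_of_pow_eq_one hxa
  have hRx : R ⊓ Subgroup.zpowers x = ⊥ := by
    have h1 : ((p : ℕ) ^ k).Coprime ((q : ℕ) ^ a) :=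
      Nat.Coprime.pow _ _ ((Nat.coprime_primes p.2 q.2).2 fun h => hq (Subtype.ext h ▸ hps))
    refine (Subgroup.disjoint_of_coprime_natCard ?_).eq_bot
    rw [hk, Nat.card_zpowers]
    exact h1.coprime_dvd_right hxq
  have hZx : Z ≤ Subgroup.zpowers x :=
    Subgroup.zpowers_le.2 (pow_mem (Subgroup.mem_zpowers x) _)
  have hRZ : R ⊓ Z = ⊥ := le_bot_iff.1 ((inf_le_inf_left R hZx).trans hRx.le)
  have hLZ : ∀ L ≤ R, (L : Set G) * Z = Z * L := fun L hL => by
    have hcomm : ∀ l ∈ L, ∀ z ∈ Z, z * l = l * z := fun l hl z hz => by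
      obtain ⟨i, rfl⟩ := Subgroup.mem_zpowers_iff.1 hz
      exact (Commute.zpow_left (hxqR l (hL hl)) i).eq
    refine subset_antisymm ?_ ?_
    · rintro _ ⟨l, hl, z, hz, rfl⟩
      exact ⟨z, hz, l, hl, hcomm l hl z hz⟩
    · rintro _ ⟨z, hz, l, hl, rfl⟩
      exact ⟨l, hl, z, hz, (hcomm l hl z hz).symm⟩
  have hLZcard : ∀ L ≤ R, Nat.card ↥(L ⊔ Z) = Nat.card L * Nat.card Z := fun L hL =>
    card_sup_of_mul_comm (hLZ L hL) (le_bot_iff.1 ((inf_le_inf_right Z hL).trans hRZ.le))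
  have hRZX : R ⊔ Z ⋖ X := by
    refine covBy_of_card_eq_prime_mul (sup_le_sup_left hZx R) q.2 ?_
    rw [hX, card_sup_of_mul_comm (Subgroup.set_mul_normal_comm _ R).symm hRx, hLZcard R le_rfl,
      Nat.card_zpowers, hZ, Nat.card_zpowers, mul_left_comm]
    congr 1
    have hx1 : x ≠ 1 := by
      rintro rfl
      exact hxR fun z _ => by rw [one_mul, mul_one]
    have hqx : (q : ℕ) ∣ orderOf x := by
      obtain ⟨i, -, hi⟩ := (Nat.dvd_prime_pow q.2).1 hxq
      rw [hi]
      refine dvd_pow_self _ ?_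
      rintro rfl
      exact hx1 (orderOf_eq_one_iff.1 (by simpa using hi))
    rw [orderOf_pow_of_dvd q.2.ne_zero hqx, Nat.mul_div_cancel' hqx]
  have hchain : ∀ (i : ℕ) (L : Subgroup G), L ≤ R → Nat.card L * (p : ℕ) ^ i = Nat.card R →
      IsNMaximal (d + 1 + i) (L ⊔ Z) := by
    intro i
    induction i with
    | zero =>
      intro L hL hLc
      rw [Subgroup.eq_of_le_of_card_ge hL (by rw [← hLc, pow_zero, mul_one])]
      exact ⟨X, hd, hRZX⟩
    | succ i ihi =>
      intro L hL hLc
      obtain ⟨l, hl⟩ : ∃ l, Nat.card L = (p : ℕ) ^ l := by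
        obtain ⟨l, -, hl⟩ := (Nat.dvd_prime_pow p.2).1 (hk ▸ Subgroup.card_dvd_of_le hL)
        exact ⟨l, hl⟩
      have hLc' : Nat.card (L.subgroupOf R) = (p : ℕ) ^ l := by
        rw [← hl]
        exact Nat.card_congr (Subgroup.subgroupOfEquivOfLe hL).toEquiv
      obtain ⟨K, hK, hLK⟩ := Sylow.exists_subgroup_card_pow_prime_le (p : ℕ) (m := l + 1)
        (G := R) ⟨(p : ℕ) ^ i, by rw [← hLc, hl]; ring⟩ _ hLc' (Nat.le_succ l)
      have hKc : Nat.card (K.map R.subtype) = (p : ℕ) ^ (l + 1) := by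
        rw [← hK]
        exact Subgroup.card_map_of_injective R.subtype_injective
      have hKR : K.map R.subtype ≤ R := Subgroup.map_subtype_le K
      have hLK' : L ≤ K.map R.subtype := by
        have := Subgroup.map_mono (f := R.subtype) hLK
        rwa [Subgroup.subgroupOf_map_subtype, inf_eq_left.2 hL] at this
      refine ⟨K.map R.subtype ⊔ Z, ihi _ hKR (by rw [hKc, ← hLc, hl]; ring), ?_⟩
      refine covBy_of_card_eq_prime_mul (sup_le_sup_right hLK' Z) p.2 ?_
      rw [hLZcard _ hKR, hLZcard L hL, hKc, hl]
      ring
  intro q' hq' y b hyb z hz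
  by_contra hw
  have hzR : y * z * y⁻¹ ∈ R := hRn.conj_mem z hz y
  obtain ⟨K, hK, hzK, hwK⟩ := exists_subgroup_card_separating hRcomm p.2
    (fun r => Subtype.ext (by simpa using hexp r r.2)) hk (m := k - j) (by omega) (by omega)
    (z := ⟨z, hz⟩) (w := ⟨y * z * y⁻¹, hzR⟩) (fun hmem => hw (by
      obtain ⟨i, hi⟩ := Subgroup.mem_zpowers_iff.1 hmem
      exact Subgroup.mem_zpowers_iff.2 ⟨i, congrArg Subtype.val hi⟩))
  have hKR : K.map R.subtype ≤ R := Subgroup.map_subtype_le K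
  have hKc : Nat.card (K.map R.subtype) = (p : ℕ) ^ (k - j) := by
    rw [← hK]
    exact Subgroup.card_map_of_injective R.subtype_injective
  have hmax := hchain j _ hKR (by rw [hKc, hk, ← pow_add, Nat.sub_add_cancel (by omega)])
  have hinf : (K.map R.subtype ⊔ Z) ⊓ R ≤ K.map R.subtype := by
    rintro g ⟨hg, hgR⟩
    have hg' : g ∈ (Z : Set G) * (K.map R.subtype : Subgroup G) := by
      rw [← coe_sup_of_mul_comm (hLZ _ hKR)]
      exact hg
    obtain ⟨u, hu, l, hl, rfl⟩ := hg'
    have huR : u ∈ R := (R.mul_mem_cancel_right (hKR hl)).1 hgR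
    have hu1 : u ∈ R ⊓ Z := ⟨huR, hu⟩
    rw [hRZ, Subgroup.mem_bot] at hu1
    rw [hu1]
    simpa using hl
  have hzmem : z ∈ (K.map R.subtype ⊔ Z) ⊓ R :=
    ⟨Subgroup.mem_sup_left ⟨⟨z, hz⟩, hzK, rfl⟩, hz⟩
  obtain ⟨r, hrK, hr⟩ := hinf ((h _ hmax).conj_mem_inf hσ hs hRs hq' hyb hzmem)
  exact hwK ((Subtype.ext hr : r = ⟨y * z * y⁻¹, hzR⟩) ▸ hrK)

theorem IsChiefFactor.map_mk' {K H : Subgroup G} [K.Normal] (h : IsChiefFactor K H) :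
    IsChiefFactor ⊥ (H.map (QuotientGroup.mk' K)) := by
  obtain ⟨-, hH, hKH, hmin⟩ := h
  have hsurj := QuotientGroup.mk'_surjective K
  refine ⟨inferInstance, hH.map _ hsurj, bot_lt_iff_ne_bot.2 fun h0 => ?_, fun N hN _ hNH => ?_⟩
  · rw [Subgroup.map_eq_bot_iff, QuotientGroup.ker_mk'] at h0
    exact hKH.not_ge h0
  · have h1 : N.comap (QuotientGroup.mk' K) ≤ H := by
      have := Subgroup.comap_mono (f := QuotientGroup.mk' K) hNH
      rwa [Subgroup.comap_map_eq_self (by rw [QuotientGroup.ker_mk']; exact hKH.le)] at this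
    rw [← Subgroup.map_comap_eq_self_of_surjective hsurj N]
    refine (hmin _ (hN.comap _) (QuotientGroup.le_comap_mk' K N) h1).imp (fun h2 => ?_) fun h2 => ?_
    · rw [h2, QuotientGroup.map_mk'_self]
    · rw [h2]

/-- If the `q`-elements of `G ⧸ K`, `q ∉ s`, normalize all subgroups of the chief factor `H / K`,
an `s`-group, then `H / K` is isomorphic to a chief factor of each Hall `s`-subgroup `S` of `G`:
together with `S` these elements generate `G`, so `S` acts irreducibly. -/
theorem IsChiefFactor.subgroupOf_isHall [Finite G] {K H S : Subgroup G} [K.Normal]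
    (h : IsChiefFactor K H) {s : Set Nat.Primes} (hS : IsHall s S)
    (hKH : IsPiNumber s (K.relIndex H))
    (hconj : ∀ q : Nat.Primes, q ∉ s → ∀ (y : G ⧸ K) (a : ℕ), y ^ (q : ℕ) ^ a = 1 →
      ∀ z ∈ H.map (QuotientGroup.mk' K), y * z * y⁻¹ ∈ Subgroup.zpowers z) :
    IsChiefFactor (K.subgroupOf S) (H.subgroupOf S) ∧
      (K.subgroupOf S).relIndex (H.subgroupOf S) = K.relIndex H := by
  obtain ⟨hK, hH, hlt, hmin⟩ := h
  have hprod : K ⊔ H ⊓ S = H := by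
    refine le_antisymm (sup_le hlt.le inf_le_left) (Subgroup.relIndex_eq_one.1 ?_)
    have h1 : (K ⊔ H ⊓ S).relIndex H ∣ S.index := by
      refine (Subgroup.relIndex_dvd_of_le_left H (le_sup_right : H ⊓ S ≤ _)).trans ?_
      rw [inf_comm, Subgroup.inf_relIndex_right]
      exact relIndex_dvd_index_of_normal_right S H
    exact Nat.eq_one_of_dvd_coprimes (hKH.coprime hS.2)
      (Subgroup.relIndex_dvd_of_le_left H le_sup_left) h1
  have hidx : (K.subgroupOf S).relIndex (H.subgroupOf S) = K.relIndex H := by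
    rw [Subgroup.subgroupOf, Subgroup.relIndex_comap, Subgroup.subgroupOf_map_subtype,
      ← Subgroup.relIndex_sup_left, hprod]
  refine ⟨⟨inferInstance, inferInstance, lt_of_le_of_ne (Subgroup.comap_mono hlt.le) fun h0 => ?_,
    fun N hN hKN hNH => ?_⟩, hidx⟩
  · rw [h0, Subgroup.relIndex_self] at hidx
    exact hlt.not_ge (Subgroup.relIndex_eq_one.1 hidx.symm)
  set T := K ⊔ N.map S.subtype with hT
  have hTH : T ≤ H := sup_le hlt.le (Subgroup.map_le_iff_le_comap.2 hNH)
  have hST : S ≤ Subgroup.normalizer (T : Set G) := by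
    have h1 : S ≤ Subgroup.normalizer ((N.map S.subtype : Subgroup G) : Set G) := by
      rw [← Subgroup.normal_subgroupOf_iff_le_normalizer (Subgroup.map_subtype_le N),
        Subgroup.subgroupOf, Subgroup.comap_map_eq_self_of_injective S.subtype_injective]
      exact hN
    exact (le_inf Subgroup.le_normalizer_of_normal h1).trans
      (Subgroup.normalizer_inf_normalizer_le_normalizer_sup K _)
  have hTn : T.Normal := by
    rw [← Subgroup.normalizer_eq_top_iff, ← Subgroup.index_eq_one]
    by_contra hne
    obtain ⟨q, hq, hqd⟩ := Nat.exists_prime_and_dvd hne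
    have hqs : (⟨q, hq⟩ : Nat.Primes) ∉ s :=
      hS.2 ⟨q, hq⟩ (hqd.trans (Subgroup.index_dvd_of_le hST))
    have hmem : ∀ (y : G) (a : ℕ), y ^ q ^ a = 1 → ∀ t ∈ T, y * t * y⁻¹ ∈ T := by
      intro y a hya t ht
      have h1 := hconj ⟨q, hq⟩ hqs (QuotientGroup.mk' K y) a (by rw [← map_pow, hya, map_one])
        (QuotientGroup.mk' K t) ⟨t, hTH ht, rfl⟩
      obtain ⟨i, hi⟩ := Subgroup.mem_zpowers_iff.1 h1
      rw [← map_zpow, ← map_inv, ← map_mul, ← map_mul] at hi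
      have h2 : (t ^ i)⁻¹ * (y * t * y⁻¹) ∈ K := QuotientGroup.eq.1 hi
      exact (T.mul_mem_cancel_left (inv_mem (zpow_mem ht i))).1 (Subgroup.mem_sup_left h2)
    refine not_dvd_index_of_pow_eq_one_mem hq (fun y a hya => ?_) hqd
    refine Subgroup.mem_normalizer_iff.2 fun t => ⟨hmem y a hya t, fun ht => ?_⟩
    have h1 := hmem y⁻¹ a (by rw [inv_pow, hya, inv_one]) _ ht
    simpa [mul_assoc] using h1
  refine (hmin T hTn le_sup_left hTH).imp (fun h1 => ?_) fun h1 => ?_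
  · refine le_antisymm ?_ hKN
    rw [← Subgroup.map_subtype_le_map_subtype, Subgroup.subgroupOf_map_subtype]
    exact le_inf (h1 ▸ le_sup_right) (Subgroup.map_subtype_le N)
  · refine le_antisymm hNH fun x hx => ?_
    have hx' : (x : G) ∈ T := h1.symm ▸ (hx : (x : G) ∈ H)
    obtain ⟨g, hg, _, ⟨n, hn, rfl⟩, hgn⟩ := Subgroup.mem_sup_of_normal_left.1 hx'
    have hgS : g = ((x * n⁻¹ : S) : G) := by
      rw [Subgroup.coe_mul, Subgroup.coe_inv, ← hgn]
      simp
    have h2 : x * n⁻¹ ∈ N := hKN (show ((x * n⁻¹ : S) : G) ∈ K from hgS ▸ hg)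
    exact (N.mul_mem_cancel_right (inv_mem hn)).1 h2

theorem le_chiefRank [Finite G] {p k : ℕ} (hp : p.Prime) {K H : Subgroup G}
    (h : IsChiefFactor K H) (hk : K.relIndex H = p ^ k) : k ≤ chiefRank G :=
  le_csSup chiefRank_bddAbove ⟨p, hp, K, H, h, hk⟩

theorem one_le_chiefRank [Finite G] [Group.IsSolvable G] [Nontrivial G] : 1 ≤ chiefRank G := by
  obtain ⟨R, hR⟩ := exists_isChiefFactor_bot (G := G)
  obtain ⟨p, hp, k, hk⟩ := hR.exists_card_eq_prime_pow
  refine le_trans (Nat.one_le_iff_ne_zero.2 ?_)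
    (le_chiefRank hp hR (by rwa [Subgroup.relIndex_bot_left]))
  rintro rfl
  exact hR.2.2.1.ne' (Subgroup.card_eq_one.1 (by simpa using hk))

/-- The bound for the rank, for any `n ≥ 2` such that the `n`-maximal subgroups permute with Hall
subgroups. Both alternatives of `lt_or_conj_mem_zpowers` suffice: `k < n` as `1 ≤ r`, and `k ≤ r`
as `2 ≤ n`. -/
theorem chiefRank_le_add_sub_two [Finite G] [Group.IsSolvable G] (hσ : Setoid.IsPartition σ)
    (hG : HasPrimarySeries σ G) {𝓗 : Set (Subgroup G)} (h𝓗 : IsCompleteHallSet σ 𝓗) {n r : ℕ}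
    (hn : 2 ≤ n) (h : ∀ H : Subgroup G, IsNMaximal n H → PermutesWithHall σ H)
    (hr : ∀ H ∈ 𝓗, chiefRank H ≤ r) : chiefRank G ≤ n + r - 2 := by
  refine csSup_le' ?_
  rintro k ⟨p, hp, K, H, hKH, hk⟩
  have hKn := hKH.1
  obtain ⟨s, hs, hps⟩ := (hσ.2 ⟨p, hp⟩).exists
  have hk0 : k ≠ 0 := by
    rintro rfl
    exact hKH.2.2.1.not_ge (Subgroup.relIndex_eq_one.1 (by simpa using hk))
  have hpG : p ∣ Nat.card G :=
    (hk ▸ dvd_pow_self p hk0 : p ∣ K.relIndex H).trans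
      ((Subgroup.relIndex_dvd_card K H).trans (Subgroup.card_subgroup_dvd_card H))
  obtain ⟨S, ⟨hS𝓗, hS⟩, -⟩ := h𝓗.2 s ⟨hs, ⟨p, hp⟩, hps, hpG⟩
  have hSr := hr S hS𝓗
  have hpS : p ∣ Nat.card S := by
    rw [← Subgroup.card_mul_index S, hp.dvd_mul] at hpG
    exact hpG.resolve_right fun hd => hS.2 ⟨p, hp⟩ hd hps
  have hSnt : Nontrivial S := Finite.one_lt_card_iff_nontrivial.1
    (hp.one_lt.trans_le (Nat.le_of_dvd Nat.card_pos hpS))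
  have hr1 : 1 ≤ r := one_le_chiefRank.trans hSr
  have hsurj := QuotientGroup.mk'_surjective K
  have hcard : Nat.card (H.map (QuotientGroup.mk' K)) = p ^ k := by
    rw [← Subgroup.relIndex_ker, QuotientGroup.ker_mk', hk]
  rcases lt_or_conj_mem_zpowers (p := ⟨p, hp⟩) hσ (hG.of_surjective _ hsurj) (n := n) (by omega)
    (fun V hV => by
      have := (h _ (hV.comap hsurj)).map hsurj
      rwa [Subgroup.map_comap_eq_self_of_surjective hsurj] at this)
    hKH.map_mk' hcard hs hps with h1 | h1
  · omega
  · obtain ⟨h2, h3⟩ := hKH.subgroupOf_isHall hS (hk ▸ IsPiNumber.pow (p := ⟨p, hp⟩) hps k) h1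
    have := le_chiefRank hp h2 (h3.trans hk)
    omega

end SigmaGroup

theorem theorem1p2 (σ : Set (Set Nat.Primes)) (hσ : Setoid.IsPartition σ)
    (G : Type*) [Group G] [Finite G] (hG : SigmaGroup.IsSigmaSoluble σ G)
    (𝓗 : Set (Subgroup G)) (h𝓗 : SigmaGroup.IsCompleteHallSet σ 𝓗) :
    (∀ r : ℕ, Group.IsSolvable G → ¬ SigmaGroup.IsSigmaNilpotent σ G →
      (∀ H ∈ 𝓗, SigmaGroup.chiefRank H ≤ r) →
        (SigmaGroup.chiefRank G : ℤ) ≤ (SigmaGroup.mSigmaQ σ G : ℤ) + (r : ℤ) - 2) ∧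
    SigmaGroup.sigmaNilpotentLength σ G ≤ (SigmaGroup.mSigma σ G : ℕ∞) ∧
    (Group.IsSolvable G → ¬ SigmaGroup.IsSigmaNilpotent σ G →
      (Nat.card G).primeFactors.card ≤ SigmaGroup.mSigma σ G) := by
  open SigmaGroup in
  have hS := hG.hasPrimarySeries
  obtain ⟨hn, hm, hm'⟩ := maximalityIndex_spec (fun H : Subgroup G => IsSigmaSubnormal σ H)
  obtain ⟨hnq, hq, -⟩ := maximalityIndex_spec (fun H : Subgroup G => IsSigmaQuasinormal σ H)
  -- If the maximal subgroups are `σ`-subnormal, then `G` is `σ`-nilpotent.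
  have hone : (∀ H : Subgroup G, IsNMaximal 1 H → IsSigmaSubnormal σ H) → IsSigmaNilpotent σ G :=
    fun h => (nilpotentChain_one.1 (nilpotentChain_of_isSigmaSubnormal hσ G hS zero_lt_one
      h)).isSigmaNilpotent_of_bot_top hσ
  refine ⟨fun r hsol hnil hr => ?_, ?_, fun hsol hnil => ?_⟩
  · have hn2 : 2 ≤ mSigmaQ σ G := by
      by_contra hcon
      have h1 : mSigmaQ σ G = 1 := le_antisymm (by omega) hnq
      refine hnil (hone fun H hH => (hq H ?_).permutesWithHall.isSigmaSubnormal hσ hS)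
      rwa [← mSigmaQ, h1]
    have := chiefRank_le_add_sub_two hσ hS h𝓗 hn2 (fun H hH => (hq H hH).permutesWithHall) hr
    omega
  · exact iInf₂_le _ ((nilpotentChain_of_isSigmaSubnormal hσ G hS hn hm).hasSigmaNilpotentChain hσ)
  · change _ ≤ maximalityIndex _
    rcases (Nat.succ_le_of_lt hn).eq_or_lt with h1 | h1
    · exact absurd (hone fun H hH => hm H (h1 ▸ hH)) hnil
    · obtain ⟨H, hH, hns⟩ := hm' h1
      have := card_primeFactors_le_of_isSigmaSubnormal hσ hS (fun s hs => h𝓗.exists_isHall hs)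
        (by rwa [Nat.sub_add_cancel hn]) hH hns
      rwa [Nat.sub_add_cancel hn] at this
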